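/- Let $V:\mathbb{R}^d\to\mathbb{R}^d$ be monotone, $\langle V(\mathbf z)-V(\mathbf z'),\mathbf z-\mathbf z'\rangle\ge 0$, and $L$-smooth, $\|V(\mathbf z)-V(\mathbf z')\|\le L\|\mathbf z-\mathbf z'\|$ with $L>0$, and suppose $\|V(\mathbf x)\|\le G$ for all $\mathbf x\in\mathbb{R}^d$. Suppose further that $V$ is differentiable with Jacobian $J_V$ and that for some $\Lambda>0$, for all $\mathbf x,\mathbf y\in\mathbb{R}^d$, $$\|V(\mathbf x)-V(\mathbf y)-J_V(\mathbf y)(\mathbf x-\mathbf y)\|\le\Lambda\|\mathbf x-\mathbf y\|^2 .$$ Let $\widetilde V:\mathbb{R}^d\times\Xi\to\mathbb{R}^d$ be a stochastic oracle with $\mathbb{E}_\xi[\widetilde V(\mathbf z,\xi)]=V(\mathbf z)$ and $\mathbb{E}_\xi\|V(\mathbf z)-\widetilde V(\mathbf z,\xi)\|^2\le\sigma^2$ for every $\mathbf z$, where $\sigma\ge0$. For integers $M,K,R\ge1$, $H\ge 0$, $T=KR$, and step sizes $\eta,\gamma>0$, the algorithm LIPPAX starts from $\mathbf z_0^m=\mathbf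 0$ for $m=1,\dots,M$ and, in each round $t=1,\dots,T$, each machine $m$ sets $\mathbf x_{t,0}^m=\mathbf z_{t-1}^m$, $$\mathbf x_{t,\ell}^m=\mathbf x_{t,\ell-1}^m-\gamma\Big(\widetilde V(\mathbf x_{t,\ell-1}^m)+\tfrac1\eta(\mathbf x_{t,\ell-1}^m-\mathbf z_{t-1}^m)\Big)\quad(\ell=1,\dots,H),\qquad \mathbf x_t^m=\mathbf x_{t,H}^m,$$ and then $\mathbf z_t^m=\mathbf z_{t-1}^m-\eta\widetilde V(\mathbf x_t^m)$ if $K\nmid t$, and $\mathbf z_t^m=\frac1M\sum_{m'=1}^M\big(\mathbf z_{t-1}^{m'}-\eta\widetilde V(\mathbf x_t^{m'})\big)$ if $K\mid t$. Every evaluation of $\widetilde V$ uses a fresh independent sample $\xi$. The output is $\mathbf x_o=\frac1{MT}\sum_{m=1}^M\sum_{t=1}^T\mathbf x_t^m$. Let $D>0$, $\mathcal Z_D=\{\mathbf z\in\mathbb{R}^d:\|\mathbf z\|\le D\}$, $$\eta=\min\left\{\frac1L,\frac{D^{2/5}}{K^{3/5}R^{1/5}\sigma^{2/5}L^{2/5}},\frac{D^{2/3}}{K^{2/3}R^{1/3}\sigma^{2/3}L^{1/3}},\frac{D^{1/2}}{K^{1/4}R^{1/4}\sigma^{1/2}L^{1/2}},\frac{D^{1/3}}{\Lambda^{1/3}\sigma^{2/3}R^{1/6}K^{1/6}},\frac{D\sqrt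 M}{K^{1/2}R^{1/2}\sigma}\right\}$$ (with $\eta=1/L$ if $\sigma=0$) and $\gamma=\frac{1}{\eta(L+1/\eta)^2}$. Assume $\eta\le1$, which holds in particular whenever $L\ge1$. Then $$\begin{aligned}\mathbb{E}\Big[\sup_{\mathbf z\in\mathcal Z_D}\langle V(\mathbf z),\mathbf x_o-\mathbf z\rangle\Big]\le{}&240\left[\frac{D^2L}{KR}+\frac{D^{4/3}L^{1/3}\sigma^{2/3}}{K^{1/3}R^{2/3}}+\frac{D\sigma}{\sqrt{MKR}}\right]\\&+240\left[\frac{D^{8/5}\sigma^{2/5}L^{2/5}}{K^{2/5}R^{4/5}}+\frac{D^{3/2}\sigma^{1/2}L^{1/2}}{K^{3/4}R^{3/4}}+\frac{D^{5/3}d^{1/6}\Lambda^{1/3}\sigma^{2/3}}{R^{5/6}K^{5/6}}\right]\\&+\frac{10H^2\Lambda^2G^4+60G^2+120G^2K^2}{4^H}.\end{aligned}$$ -/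

import Mathlib

open MeasureTheory ProbabilityTheory

noncomputable section

namespace FedVI

/-- The Euclidean space `ℝ^d`. -/
abbrev Vec (d : ℕ) : Type := EuclideanSpace ℝ (Fin d)

/-- Monotonicity of an operator. -/
def MonotoneOp {d : ℕ} (V : Vec d → Vec d) : Prop :=
  ∀ z z' : Vec d, 0 ≤ inner ℝ (V z - V z') (z - z')

/-- `L`-smoothness of an operator, i.e. Lipschitz continuity with constant `L`. -/
def SmoothOp {d : ℕ} (L : ℝ) (V : Vec d → Vec d) : Prop :=
  ∀ z z' : Vec d, ‖V z - V z'‖ ≤ L * ‖z - z'‖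

/-- Second-order boundedness with constant `Lam`; the Jacobian of `V` at `y` is `fderiv ℝ V y`. -/
def SecondOrderBounded {d : ℕ} (Lam : ℝ) (V : Vec d → Vec d) : Prop :=
  Differentiable ℝ V ∧
    ∀ x y : Vec d, ‖V x - V y - fderiv ℝ V y (x - y)‖ ≤ Lam * ‖x - y‖ ^ 2

/-- `Vt` is an unbiased stochastic oracle for `V`, for samples with law `P`, whose variance is at
most `σ ^ 2` at every point. -/
structure IsOracle {d : ℕ} {Ξ : Type*} [MeasurableSpace Ξ] (V : Vec d → Vec d)
    (Vt : Vec d → Ξ → Vec d) (P : Measure Ξ) (σ : ℝ) : Prop where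
  measurable : Measurable (Function.uncurry Vt)
  integrable : ∀ z, Integrable (Vt z) P
  unbiased : ∀ z, ∫ s, Vt z s ∂P = V z
  integrable_sq : ∀ z, Integrable (fun s => ‖V z - Vt z s‖ ^ 2) P
  variance_le : ∀ z, ∫ s, ‖V z - Vt z s‖ ^ 2 ∂P ≤ σ ^ 2

/-- The samples `ξ t m ℓ` (round, machine, query) are independent and all have law `P`. -/
structure IsIIDSample {Ω Ξ : Type*} [MeasurableSpace Ω] [MeasurableSpace Ξ] {M : ℕ}
    (ξ : ℕ → Fin M → ℕ → Ω → Ξ) (P : Measure Ξ) (μ : Measure Ω) : Prop where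
  measurable : ∀ t m ℓ, Measurable (ξ t m ℓ)
  law : ∀ t m ℓ, μ.map (ξ t m ℓ) = P
  indep : iIndepFun (fun i : ℕ × Fin M × ℕ => ξ i.1 i.2.1 i.2.2) μ

section Algorithm

variable {d : ℕ} {Ξ : Type*}

/-- Inner loop of LIPPAX on one machine in one round: stochastic steps of size `γ` on
`x ↦ V x + (x - z) / η`, started at `z`. Step `ℓ = 1, 2, …` uses the sample `s ℓ`. -/
def innerLoop (Vt : Vec d → Ξ → Vec d) (η γ : ℝ) (z : Vec d) (s : ℕ → Ξ) : ℕ → Vec d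
  | 0 => z
  | ℓ + 1 =>
      innerLoop Vt η γ z s ℓ
        - γ • (Vt (innerLoop Vt η γ z s ℓ) (s (ℓ + 1))
            + (1 / η) • (innerLoop Vt η γ z s ℓ - z))

/-- The local step `z - η Vt(x)`, where `x` is the result of `H` inner steps from `z`; this last
query uses the fresh sample `s (H + 1)`. -/
def localStep (Vt : Vec d → Ξ → Vec d) (η γ : ℝ) (H : ℕ) (z : Vec d) (s : ℕ → Ξ) : Vec d :=
  z - η • Vt (innerLoop Vt η γ z s H) (s (H + 1))

/-- The LIPPAX iterates `z_t^m` for `M` machines that average their iterates whenever `K ∣ t`,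
run on the samples `s t m ℓ`. -/
def lippaxZ {M : ℕ} (Vt : Vec d → Ξ → Vec d) (η γ : ℝ) (H K : ℕ) (s : ℕ → Fin M → ℕ → Ξ) :
    ℕ → Fin M → Vec d
  | 0 => fun _ => 0
  | t + 1 => fun m =>
      if (t + 1) % K = 0 then
        (1 / (M : ℝ)) • ∑ m' : Fin M,
          localStep Vt η γ H (lippaxZ Vt η γ H K s t m') (s (t + 1) m')
      else
        localStep Vt η γ H (lippaxZ Vt η γ H K s t m) (s (t + 1) m)

/-- The LIPPAX iterates `x_t^m`, for `t ≥ 1`. -/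
def lippaxX {M : ℕ} (Vt : Vec d → Ξ → Vec d) (η γ : ℝ) (H K : ℕ) (s : ℕ → Fin M → ℕ → Ξ)
    (t : ℕ) (m : Fin M) : Vec d :=
  innerLoop Vt η γ (lippaxZ Vt η γ H K s (t - 1) m) (s t m) H

/-- The output of LIPPAX after `T` rounds: the average of all `x_t^m`, `1 ≤ t ≤ T`. -/
def lippaxOutput {M : ℕ} (Vt : Vec d → Ξ → Vec d) (η γ : ℝ) (H K T : ℕ)
    (s : ℕ → Fin M → ℕ → Ξ) : Vec d :=
  (1 / ((M : ℝ) * (T : ℝ))) •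
    ∑ m : Fin M, ∑ t ∈ Finset.Icc 1 T, lippaxX Vt η γ H K s t m

end Algorithm

/-- The restricted gap `sup ⟨V z, x - z⟩` over the ball of radius `D` around the common starting
point `0` of the machines. -/
def gap {d : ℕ} (V : Vec d → Vec d) (D : ℝ) (x : Vec d) : ℝ :=
  ⨆ z : Metric.closedBall (0 : Vec d) D, inner ℝ (V (z : Vec d)) (x - (z : Vec d))

/-- The step size `η`. For `σ = 0` the terms with `σ` in the denominator are infinite, so that the
minimum is `1 / L`. -/
def stepSize (L D σ Lam : ℝ) (M K R : ℕ) : ℝ :=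
  if σ = 0 then 1 / L
  else
    min (1 / L) <|
    min (D ^ (2 / 5 : ℝ) /
      ((K : ℝ) ^ (3 / 5 : ℝ) * (R : ℝ) ^ (1 / 5 : ℝ) * σ ^ (2 / 5 : ℝ) * L ^ (2 / 5 : ℝ))) <|
    min (D ^ (2 / 3 : ℝ) /
      ((K : ℝ) ^ (2 / 3 : ℝ) * (R : ℝ) ^ (1 / 3 : ℝ) * σ ^ (2 / 3 : ℝ) * L ^ (1 / 3 : ℝ))) <|
    min (D ^ (1 / 2 : ℝ) /
      ((K : ℝ) ^ (1 / 4 : ℝ) * (R : ℝ) ^ (1 / 4 : ℝ) * σ ^ (1 / 2 : ℝ) * L ^ (1 / 2 : ℝ))) <|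
    min (D ^ (1 / 3 : ℝ) /
      (Lam ^ (1 / 3 : ℝ) * σ ^ (2 / 3 : ℝ) * (R : ℝ) ^ (1 / 6 : ℝ) * (K : ℝ) ^ (1 / 6 : ℝ)))
      (D * Real.sqrt M / ((K : ℝ) ^ (1 / 2 : ℝ) * (R : ℝ) ^ (1 / 2 : ℝ) * σ))

/-- The inner step size `γ`. -/
def innerStepSize (L η : ℝ) : ℝ := 1 / (η * (L + 1 / η) ^ 2)

end FedVI

end

noncomputable section

set_option linter.unusedSectionVars false

namespace FedVI

section Operators

variable {d : ℕ} {V : Vec d → Vec d} {L η : ℝ}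

/-- Squared contraction factor of a deterministic inner step, for `a = η * L`. -/
def contractionFactor (a : ℝ) : ℝ :=
  (1 - 1 / (1 + a) ^ 2) ^ 2 + (1 / (1 + a) ^ 2) ^ 2 * a ^ 2

lemma innerStepSize_eq (hη : 0 < η) :
    innerStepSize L η = η * (1 / (1 + η * L) ^ 2) := by
  unfold innerStepSize
  have : L + 1 / η = (1 + η * L) / η := by field_simp; ring
  rw [this, div_pow]
  by_cases h : 1 + η * L = 0
  · simp [h]
  · field_simp

lemma ratio_nonneg (a : ℝ) : 0 ≤ 1 / (1 + a) ^ 2 := by positivity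

lemma ratio_le_one {a : ℝ} (ha : 0 ≤ a) : 1 / (1 + a) ^ 2 ≤ 1 := by
  rw [div_le_one (by positivity)]; nlinarith

lemma one_sub_ratio_le {a : ℝ} (ha : 0 ≤ a) : 1 - 1 / (1 + a) ^ 2 ≤ 2 * a := by
  have h : 0 < (1 + a) ^ 2 := by positivity
  rw [sub_le_iff_le_add, ← sub_le_iff_le_add', le_div_iff₀ h]
  nlinarith [pow_nonneg ha 3, sq_nonneg a]

lemma contractionFactor_nonneg (a : ℝ) : 0 ≤ contractionFactor a := by
  unfold contractionFactor; positivity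

lemma contractionFactor_le_one_sub {a : ℝ} (ha : 0 ≤ a) :
    contractionFactor a ≤ 1 - 1 / (1 + a) ^ 2 := by
  have h : 0 < (1 + a) ^ 2 := by positivity
  have key : 1 / (1 + a) ^ 2 * a ^ 2 ≤ 1 - 1 / (1 + a) ^ 2 := by
    rw [le_sub_iff_add_le, ← mul_add_one, div_mul_eq_mul_div, div_le_one h]
    nlinarith
  unfold contractionFactor
  nlinarith [ratio_nonneg a]

lemma contractionFactor_le {a : ℝ} (ha : 0 ≤ a) (ha1 : a ≤ 1) : contractionFactor a ≤ 5 / 8 := by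
  have hc0 := ratio_nonneg a
  have hc1 := ratio_le_one ha
  have hc : 1 / 4 ≤ 1 / (1 + a) ^ 2 := by
    rw [div_le_div_iff₀ (by norm_num) (by positivity)]; nlinarith
  have hca : 1 / (1 + a) ^ 2 * (1 + a) ^ 2 = 1 := by
    have : (1 + a) ^ 2 ≠ 0 := by positivity
    field_simp
  unfold contractionFactor
  set c := 1 / (1 + a) ^ 2
  -- `c * a = (1 - c - c * a ^ 2) / 2`
  have h1 : c * a ≤ 1 / 4 := by nlinarith [mul_nonneg hc0 (sq_nonneg (1 - a))]
  have h0 : 0 ≤ c * a := by positivity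
  nlinarith

lemma contractionFactor_le_five_mul_sq {a : ℝ} (ha : 0 ≤ a) : contractionFactor a ≤ 5 * a ^ 2 := by
  have hc0 := ratio_nonneg a
  have hc1 := ratio_le_one ha
  have hc2 := one_sub_ratio_le ha
  unfold contractionFactor
  set c := 1 / (1 + a) ^ 2
  have h1 : (1 - c) ^ 2 ≤ (2 * a) ^ 2 := pow_le_pow_left₀ (by linarith) hc2 2
  have h2 : c ^ 2 ≤ 1 := pow_le_one₀ hc0 hc1
  nlinarith [sq_nonneg a]

lemma continuous_of_smoothOp (h : SmoothOp L V) (hL : 0 ≤ L) : Continuous V := by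
  have : LipschitzWith L.toNNReal V := LipschitzWith.of_dist_le_mul fun x y => by
    simpa [dist_eq_norm, hL] using h x y
  exact this.continuous

/-- A deterministic inner step contracts the squared distance to any other point. -/
lemma norm_sq_innerStep_le (hmono : MonotoneOp V) (hsmooth : SmoothOp L V) (hL : 0 ≤ L)
    (hη : 0 < η) (x p : Vec d) :
    ‖(1 - 1 / (1 + η * L) ^ 2) • (x - p) - (η * (1 / (1 + η * L) ^ 2)) • (V x - V p)‖ ^ 2
      ≤ contractionFactor (η * L) * ‖x - p‖ ^ 2 := by
  have ha : 0 ≤ η * L := by positivity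
  have hc0 := ratio_nonneg (η * L)
  have hc1 := ratio_le_one ha
  have hm := hmono x p
  have hs := hsmooth x p
  unfold contractionFactor
  set c := 1 / (1 + η * L) ^ 2
  rw [norm_sub_sq_real, norm_smul, norm_smul, inner_smul_left, inner_smul_right,
    real_inner_comm, Real.norm_of_nonneg (by linarith : 0 ≤ 1 - c),
    Real.norm_of_nonneg (by positivity : 0 ≤ η * c)]
  simp only [conj_trivial]
  have h2 : ‖V x - V p‖ ^ 2 ≤ (L * ‖x - p‖) ^ 2 := pow_le_pow_left₀ (norm_nonneg _) hs 2
  have h3 : 0 ≤ (1 - c) * (η * c * inner ℝ (V x - V p) (x - p)) :=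
    mul_nonneg (by linarith) (mul_nonneg (by positivity) hm)
  have h4 := mul_le_mul_of_nonneg_left h2 (sq_nonneg (η * c))
  nlinarith

lemma exists_resolvent (hmono : MonotoneOp V) (hsmooth : SmoothOp L V) (hL : 0 ≤ L)
    (hη : 0 < η) (z : Vec d) : ∃ p : Vec d, p + η • V p = z := by
  have ha : 0 ≤ η * L := by positivity
  have hc : 0 < 1 / (1 + η * L) ^ 2 := by positivity
  have hq0 := contractionFactor_nonneg (η * L)
  have hq1 : contractionFactor (η * L) < 1 := by
    linarith [contractionFactor_le_one_sub ha]
  have key := norm_sq_innerStep_le hmono hsmooth hL hη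
  set c := 1 / (1 + η * L) ^ 2
  set q := contractionFactor (η * L)
  let f : Vec d → Vec d := fun x => (1 - c) • x - (η * c) • V x + c • z
  have hf : ContractingWith (√q).toNNReal f := by
    refine ⟨?_, LipschitzWith.of_dist_le_mul fun x y => ?_⟩
    · simpa [← NNReal.coe_lt_coe, Real.sqrt_lt' one_pos] using hq1
    · rw [dist_eq_norm, dist_eq_norm]
      have e : f x - f y = (1 - c) • (x - y) - (η * c) • (V x - V y) := by
        simp only [f]; module
      rw [e]
      refine le_of_sq_le_sq ?_ (by positivity)
      rw [mul_pow]
      simpa [Real.sq_sqrt hq0] using key x y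
  have hfix : f (hf.fixedPoint f) = hf.fixedPoint f := hf.fixedPoint_isFixedPt
  refine ⟨hf.fixedPoint f, ?_⟩
  set p := hf.fixedPoint f
  have h1 : c • (p + η • V p) = c • z := by
    have : f p - p = 0 := by rw [hfix, sub_self]
    rw [← sub_eq_zero, ← neg_eq_zero, ← this]
    simp only [f]; module
  exact smul_right_injective _ hc.ne' h1

/-- The resolvent `(1 + η V)⁻¹`. -/
def resolvent (V : Vec d → Vec d) (η : ℝ) (z : Vec d) : Vec d :=
  Classical.epsilon fun p => p + η • V p = z

lemma resolvent_spec (hmono : MonotoneOp V) (hsmooth : SmoothOp L V) (hL : 0 ≤ L)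
    (hη : 0 < η) (z : Vec d) : resolvent V η z + η • V (resolvent V η z) = z :=
  Classical.epsilon_spec (exists_resolvent hmono hsmooth hL hη z)

lemma continuous_resolvent (hmono : MonotoneOp V) (hsmooth : SmoothOp L V) (hL : 0 ≤ L)
    (hη : 0 < η) : Continuous (resolvent V η) := by
  have : LipschitzWith 1 (resolvent V η) := LipschitzWith.of_dist_le_mul fun z w => by
    have hz := resolvent_spec hmono hsmooth hL hη z
    have hw := resolvent_spec hmono hsmooth hL hη w
    have hm := hmono (resolvent V η z) (resolvent V η w)
    set p := resolvent V η z
    set p' := resolvent V η w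
    rw [dist_eq_norm, dist_eq_norm, NNReal.coe_one, one_mul]
    have e : z - w = (p - p') + η • (V p - V p') := by rw [← hz, ← hw]; module
    have h1 : ‖p - p'‖ ^ 2 ≤ inner ℝ (z - w) (p - p') := by
      rw [e, inner_add_left, real_inner_self_eq_norm_sq, inner_smul_left]
      have := mul_nonneg hη.le hm
      simpa using this
    have h2 := real_inner_le_norm (z - w) (p - p')
    by_contra! h
    nlinarith [norm_nonneg (p - p'), norm_nonneg (z - w)]
  exact this.continuous

/-- The progress of an extragradient-type step from `z` to `z - η V x`, in terms of the
resolvent `p` of `z`. -/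
lemma progress_le (hsmooth : SmoothOp L V) (hη : 0 < η) {x p z : Vec d}
    (hp : p + η • V p = z) :
    2 * η * inner ℝ (V x) (x - z) + η ^ 2 * ‖V x‖ ^ 2 ≤
      -‖z - p‖ ^ 2 + 2 * inner ℝ (z - p) (x - p)
        + (2 * (η * L) + (η * L) ^ 2) * ‖x - p‖ ^ 2 := by
  set w := V x - V p with hw
  have hs : ‖w‖ ≤ L * ‖x - p‖ := hsmooth x p
  have hzp : z - p = η • V p := by rw [← hp]; abel
  have hxz : x - z = (x - p) - η • V p := by rw [← hp]; abel
  have hVx : V x = V p + w := by rw [hw]; abel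
  have h1 : inner ℝ w (x - p) ≤ L * ‖x - p‖ ^ 2 := by
    have := real_inner_le_norm w (x - p)
    nlinarith [norm_nonneg (x - p)]
  have h2 : ‖w‖ ^ 2 ≤ (L * ‖x - p‖) ^ 2 := pow_le_pow_left₀ (norm_nonneg _) hs 2
  rw [hxz, hVx, hzp, norm_add_sq_real, norm_smul, inner_smul_left]
  simp only [inner_sub_right, inner_add_left, inner_smul_right, real_inner_self_eq_norm_sq,
    Real.norm_of_nonneg hη.le, conj_trivial, real_inner_comm (V p) w] at *
  nlinarith [mul_le_mul_of_nonneg_left h1 hη.le, mul_le_mul_of_nonneg_left h2 (sq_nonneg η)]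

end Operators

section Mean

variable {Ω : Type*} [MeasurableSpace Ω] {μ : Measure Ω} {f g : Ω → ℝ} {a b r : ℝ}

/-- `f` is integrable with integral at most `a`. -/
structure MeanLe (μ : Measure Ω) (f : Ω → ℝ) (a : ℝ) : Prop where
  integrable : Integrable f μ
  le : ∫ ω, f ω ∂μ ≤ a

lemma MeanLe.add (hf : MeanLe μ f a) (hg : MeanLe μ g b) : MeanLe μ (fun ω => f ω + g ω) (a + b) :=
  ⟨hf.1.add hg.1, by rw [integral_add hf.1 hg.1]; exact add_le_add hf.2 hg.2⟩

lemma MeanLe.const_mul (hf : MeanLe μ f a) (hr : 0 ≤ r) : MeanLe μ (fun ω => r * f ω) (r * a) :=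
  ⟨hf.1.const_mul r, by rw [integral_const_mul]; exact mul_le_mul_of_nonneg_left hf.2 hr⟩

lemma MeanLe.of_integral (hf : Integrable f μ) (r : ℝ) :
    MeanLe μ (fun ω => r * f ω) (r * ∫ ω, f ω ∂μ) :=
  ⟨hf.const_mul r, (integral_const_mul _ _).le⟩

lemma MeanLe.of_integral_eq_zero (hf : Integrable f μ) (h : ∫ ω, f ω ∂μ = 0) (r : ℝ) :
    MeanLe μ (fun ω => r * f ω) 0 :=
  ⟨hf.const_mul r, by rw [integral_const_mul, h, mul_zero]⟩

lemma MeanLe.sum {ι : Type*} (s : Finset ι) {f : ι → Ω → ℝ} {a : ι → ℝ}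
    (h : ∀ i ∈ s, MeanLe μ (f i) (a i)) :
    MeanLe μ (fun ω => ∑ i ∈ s, f i ω) (∑ i ∈ s, a i) :=
  ⟨integrable_finsetSum _ fun i hi => (h i hi).1, by
    rw [integral_finsetSum _ fun i hi => (h i hi).1]
    exact Finset.sum_le_sum fun i hi => (h i hi).2⟩

lemma MeanLe.mono (hg : MeanLe μ g b) (hf : Integrable f μ) (h : ∀ ω, f ω ≤ g ω) (hab : b ≤ a) :
    MeanLe μ f a :=
  ⟨hf, ((integral_mono hf hg.1 h).trans hg.2).trans hab⟩

end Mean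

section SecondMoments

variable {Ω E : Type*} [MeasurableSpace Ω] {μ : Measure Ω}
  [NormedAddCommGroup E] [InnerProductSpace ℝ E]

lemma integrable_norm_sq {X : Ω → E} (hX : MemLp X 2 μ) : Integrable (fun ω => ‖X ω‖ ^ 2) μ :=
  hX.integrable_norm_pow (by norm_num)

lemma integrable_norm_mul_norm {X Y : Ω → E} (hX : MemLp X 2 μ) (hY : MemLp Y 2 μ) :
    Integrable (fun ω => ‖X ω‖ * ‖Y ω‖) μ :=
  hX.norm.integrable_mul hY.norm

lemma integrable_inner {X Y : Ω → E} (hX : MemLp X 2 μ) (hY : MemLp Y 2 μ) :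
    Integrable (fun ω => inner ℝ (X ω) (Y ω)) μ :=
  (integrable_norm_mul_norm hX hY).mono (hX.1.inner hY.1)
    (Filter.Eventually.of_forall fun ω => by
      simpa using abs_real_inner_le_norm (X ω) (Y ω))

lemma integral_norm_le_sqrt [IsProbabilityMeasure μ] {X : Ω → E} (hX : MemLp X 2 μ) {C : ℝ}
    (h : ∫ ω, ‖X ω‖ ^ 2 ∂μ ≤ C) : ∫ ω, ‖X ω‖ ∂μ ≤ √C := by
  have hint : Integrable (fun ω => ‖X ω‖) μ := (hX.integrable (by norm_num)).norm
  set m := ∫ ω, ‖X ω‖ ∂μ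
  have h0 : 0 ≤ ∫ ω, (‖X ω‖ - m) ^ 2 ∂μ := integral_nonneg fun ω => sq_nonneg _
  have h1 : ∫ ω, (‖X ω‖ - m) ^ 2 ∂μ = ∫ ω, ‖X ω‖ ^ 2 ∂μ - m ^ 2 := by
    have : ∀ ω, (‖X ω‖ - m) ^ 2 = ‖X ω‖ ^ 2 - (2 * m) * ‖X ω‖ + m ^ 2 := fun ω => by ring
    simp_rw [this]
    have hi : Integrable (fun ω => ‖X ω‖ ^ 2 - 2 * m * ‖X ω‖) μ :=
      (integrable_norm_sq hX).sub (hint.const_mul _)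
    rw [integral_add hi (integrable_const _),
      integral_sub (integrable_norm_sq hX) (hint.const_mul _), integral_const_mul]
    simp only [integral_const, probReal_univ, one_smul]
    ring
  apply Real.le_sqrt_of_sq_le
  linarith

/-- Pythagoras for orthogonal random vectors. -/
lemma integral_norm_sub_smul_sq {X Y : Ω → E} (hX : MemLp X 2 μ) (hY : MemLp Y 2 μ)
    (h : ∫ ω, inner ℝ (X ω) (Y ω) ∂μ = 0) (g : ℝ) :
    ∫ ω, ‖X ω - g • Y ω‖ ^ 2 ∂μ = ∫ ω, ‖X ω‖ ^ 2 ∂μ + g ^ 2 * ∫ ω, ‖Y ω‖ ^ 2 ∂μ := by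
  have e : ∀ ω, ‖X ω - g • Y ω‖ ^ 2
      = ‖X ω‖ ^ 2 - 2 * g * inner ℝ (X ω) (Y ω) + g ^ 2 * ‖Y ω‖ ^ 2 := fun ω => by
    rw [norm_sub_sq_real, inner_smul_right, norm_smul, mul_pow, Real.norm_eq_abs, sq_abs]
    ring
  simp_rw [e]
  have hi : Integrable (fun ω => ‖X ω‖ ^ 2 - 2 * g * inner ℝ (X ω) (Y ω)) μ :=
    (integrable_norm_sq hX).sub ((integrable_inner hX hY).const_mul _)
  rw [integral_add hi ((integrable_norm_sq hY).const_mul _),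
    integral_sub (integrable_norm_sq hX) ((integrable_inner hX hY).const_mul _),
    integral_const_mul, integral_const_mul, h]
  ring

/-- Sums of pairwise orthogonal random vectors. -/
lemma integral_norm_sum_sq {ι : Type*} (s : Finset ι) {X : ι → Ω → E}
    (hX : ∀ i ∈ s, MemLp (X i) 2 μ)
    (h : ∀ i ∈ s, ∀ j ∈ s, i ≠ j → ∫ ω, inner ℝ (X i ω) (X j ω) ∂μ = 0) :
    ∫ ω, ‖∑ i ∈ s, X i ω‖ ^ 2 ∂μ = ∑ i ∈ s, ∫ ω, ‖X i ω‖ ^ 2 ∂μ := by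
  have e : ∀ ω, ‖∑ i ∈ s, X i ω‖ ^ 2 = ∑ i ∈ s, ∑ j ∈ s, inner ℝ (X i ω) (X j ω) := fun ω => by
    rw [← real_inner_self_eq_norm_sq, sum_inner]
    simp_rw [inner_sum]
  simp_rw [e]
  rw [integral_finsetSum _ fun i hi => integrable_finsetSum _ fun j hj =>
    integrable_inner (hX i hi) (hX j hj)]
  refine Finset.sum_congr rfl fun i hi => ?_
  rw [integral_finsetSum _ fun j hj => integrable_inner (hX i hi) (hX j hj),
    Finset.sum_eq_single_of_mem i hi fun j hj hij => h i hi j hj hij.symm]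
  simp_rw [real_inner_self_eq_norm_sq]

end SecondMoments

section FreshSamples

variable {d : ℕ} {Ω Ξ : Type*} [mΩ : MeasurableSpace Ω] [MeasurableSpace Ξ] {M : ℕ}
  {μ : Measure Ω} {P : Measure Ξ} {V : Vec d → Vec d} {Vt : Vec d → Ξ → Vec d} {σ : ℝ}
  {ξ : ℕ → Fin M → ℕ → Ω → Ξ}

/-- The `σ`-algebra generated by the samples with index in `S`. -/
@[reducible]
def sampleAlgebra (ξ : ℕ → Fin M → ℕ → Ω → Ξ) (S : Set (ℕ × Fin M × ℕ)) : MeasurableSpace Ω :=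
  ⨆ j ∈ S, MeasurableSpace.comap (ξ j.1 j.2.1 j.2.2) inferInstance

lemma sampleAlgebra_mono {S S' : Set (ℕ × Fin M × ℕ)} (h : S ⊆ S') :
    sampleAlgebra ξ S ≤ sampleAlgebra ξ S' :=
  biSup_mono fun _ hj => h hj

lemma IsIIDSample.sampleAlgebra_le (hξ : IsIIDSample ξ P μ) (S : Set (ℕ × Fin M × ℕ)) :
    sampleAlgebra ξ S ≤ mΩ :=
  iSup₂_le fun j _ => (hξ.measurable j.1 j.2.1 j.2.2).comap_le

lemma measurable_sample {S : Set (ℕ × Fin M × ℕ)} {i : ℕ × Fin M × ℕ} (hi : i ∈ S) :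
    Measurable[sampleAlgebra ξ S] (ξ i.1 i.2.1 i.2.2) :=
  Measurable.of_comap_le
    (le_iSup₂_of_le (f := fun (j : ℕ × Fin M × ℕ) (_ : j ∈ S) =>
      MeasurableSpace.comap (ξ j.1 j.2.1 j.2.2) inferInstance) i hi le_rfl)

lemma IsIIDSample.indepFun (hξ : IsIIDSample ξ P μ) {S : Set (ℕ × Fin M × ℕ)}
    {i : ℕ × Fin M × ℕ} (hi : i ∉ S) {β : Type*} [MeasurableSpace β] {Y : Ω → β}
    (hY : Measurable[sampleAlgebra ξ S] Y) : IndepFun Y (ξ i.1 i.2.1 i.2.2) μ := by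
  have h := indep_iSup_of_disjoint (S := S) (T := {i})
    (m := fun j : ℕ × Fin M × ℕ => MeasurableSpace.comap (ξ j.1 j.2.1 j.2.2) inferInstance)
    (fun j => (hξ.measurable j.1 j.2.1 j.2.2).comap_le) hξ.indep
    (Set.disjoint_singleton_right.2 hi)
  rw [iSup_singleton] at h
  rw [IndepFun_iff_Indep]
  exact indep_of_indep_of_le_left h hY.comap_le

/-- Noise of a query at `X` with the sample of index `i`. -/
def queryNoise (V : Vec d → Vec d) (Vt : Vec d → Ξ → Vec d) (ξ : ℕ → Fin M → ℕ → Ω → Ξ)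
    (i : ℕ × Fin M × ℕ) (X : Ω → Vec d) (ω : Ω) : Vec d :=
  Vt (X ω) (ξ i.1 i.2.1 i.2.2 ω) - V (X ω)

variable [IsProbabilityMeasure μ] [IsProbabilityMeasure P]

lemma IsIIDSample.map_prod (hξ : IsIIDSample ξ P μ) {S : Set (ℕ × Fin M × ℕ)}
    {i : ℕ × Fin M × ℕ} (hi : i ∉ S) {β : Type*} [MeasurableSpace β] {Y : Ω → β}
    (hY : Measurable[sampleAlgebra ξ S] Y) :
    μ.map (fun ω => (Y ω, ξ i.1 i.2.1 i.2.2 ω)) = (μ.map Y).prod P := by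
  have hY' : Measurable Y := hY.mono (hξ.sampleAlgebra_le S) le_rfl
  rw [(indepFun_iff_map_prod_eq_prod_map_map hY'.aemeasurable
    (hξ.measurable _ _ _).aemeasurable).1 (hξ.indepFun hi hY), hξ.law]

lemma measurable_queryNoise (hV : Measurable V) (hVt : Measurable (Function.uncurry Vt))
    {S : Set (ℕ × Fin M × ℕ)} {i : ℕ × Fin M × ℕ} (hi : i ∈ S) {X : Ω → Vec d}
    (hX : Measurable[sampleAlgebra ξ S] X) :
    Measurable[sampleAlgebra ξ S] (queryNoise V Vt ξ i X) :=
  (hVt.comp (hX.prodMk (measurable_sample hi))).sub (hV.comp hX)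

lemma lintegral_queryNoise_sq_le (hV : Measurable V) (ho : IsOracle V Vt P σ)
    (hξ : IsIIDSample ξ P μ) {S : Set (ℕ × Fin M × ℕ)} {i : ℕ × Fin M × ℕ} (hi : i ∉ S)
    {X : Ω → Vec d} (hX : Measurable[sampleAlgebra ξ S] X) :
    ∫⁻ ω, ENNReal.ofReal (‖queryNoise V Vt ξ i X ω‖ ^ 2) ∂μ ≤ ENNReal.ofReal (σ ^ 2) := by
  have hX' : Measurable X := hX.mono (hξ.sampleAlgebra_le S) le_rfl
  have hm : Measurable fun y : Vec d × Ξ => ENNReal.ofReal (‖Vt y.1 y.2 - V y.1‖ ^ 2) :=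
    ((ho.measurable.sub (hV.comp measurable_fst)).norm.pow_const 2).ennreal_ofReal
  have h1 : ∫⁻ ω, ENNReal.ofReal (‖queryNoise V Vt ξ i X ω‖ ^ 2) ∂μ
      = ∫⁻ y, ENNReal.ofReal (‖Vt y.1 y.2 - V y.1‖ ^ 2) ∂((μ.map X).prod P) := by
    rw [← hξ.map_prod hi hX, lintegral_map hm (hX'.prodMk (hξ.measurable _ _ _))]
    rfl
  rw [h1, lintegral_prod _ hm.aemeasurable]
  have : IsProbabilityMeasure (μ.map X) := Measure.isProbabilityMeasure_map hX'.aemeasurable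
  calc ∫⁻ x, ∫⁻ s, ENNReal.ofReal (‖Vt x s - V x‖ ^ 2) ∂P ∂(μ.map X)
      ≤ ∫⁻ _, ENNReal.ofReal (σ ^ 2) ∂(μ.map X) := by
        refine lintegral_mono fun x => ?_
        simp_rw [norm_sub_rev (Vt x _)]
        rw [← ofReal_integral_eq_lintegral_ofReal (ho.integrable_sq x)
          (Filter.Eventually.of_forall fun s => by positivity)]
        exact ENNReal.ofReal_le_ofReal (ho.variance_le x)
    _ = ENNReal.ofReal (σ ^ 2) := by simp

lemma memLp_queryNoise (hV : Measurable V) (ho : IsOracle V Vt P σ)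
    (hξ : IsIIDSample ξ P μ) {S : Set (ℕ × Fin M × ℕ)} {i : ℕ × Fin M × ℕ} (hi : i ∉ S)
    {X : Ω → Vec d} (hX : Measurable[sampleAlgebra ξ S] X) :
    MemLp (queryNoise V Vt ξ i X) 2 μ := by
  have hX' : Measurable X := hX.mono (hξ.sampleAlgebra_le S) le_rfl
  have hm : Measurable (queryNoise V Vt ξ i X) :=
    (ho.measurable.comp (hX'.prodMk (hξ.measurable _ _ _))).sub (hV.comp hX')
  rw [memLp_two_iff_integrable_sq_norm hm.aestronglyMeasurable]
  refine ⟨(hm.norm.pow_const 2).aestronglyMeasurable, ?_⟩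
  rw [hasFiniteIntegral_iff_ofReal (Filter.Eventually.of_forall fun ω => by positivity)]
  exact (lintegral_queryNoise_sq_le hV ho hξ hi hX).trans_lt ENNReal.ofReal_lt_top

lemma integral_queryNoise_sq_le (hV : Measurable V) (ho : IsOracle V Vt P σ)
    (hξ : IsIIDSample ξ P μ) {S : Set (ℕ × Fin M × ℕ)} {i : ℕ × Fin M × ℕ} (hi : i ∉ S)
    {X : Ω → Vec d} (hX : Measurable[sampleAlgebra ξ S] X) :
    ∫ ω, ‖queryNoise V Vt ξ i X ω‖ ^ 2 ∂μ ≤ σ ^ 2 := by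
  have h := lintegral_queryNoise_sq_le hV ho hξ hi hX
  rw [← ofReal_integral_eq_lintegral_ofReal (integrable_norm_sq (memLp_queryNoise hV ho hξ hi hX))
    (Filter.Eventually.of_forall fun ω => by positivity)] at h
  exact (ENNReal.ofReal_le_ofReal_iff (sq_nonneg σ)).1 h

/-- The noise of a query is orthogonal to everything that does not depend on its sample. -/
lemma integral_inner_queryNoise (hV : Measurable V) (ho : IsOracle V Vt P σ)
    (hξ : IsIIDSample ξ P μ) {S : Set (ℕ × Fin M × ℕ)} {i : ℕ × Fin M × ℕ} (hi : i ∉ S)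
    {X Y : Ω → Vec d} (hX : Measurable[sampleAlgebra ξ S] X)
    (hY : Measurable[sampleAlgebra ξ S] Y) (hY2 : MemLp Y 2 μ) :
    ∫ ω, inner ℝ (Y ω) (queryNoise V Vt ξ i X ω) ∂μ = 0 := by
  have hXY : Measurable[sampleAlgebra ξ S] fun ω => (X ω, Y ω) := hX.prodMk hY
  have hXY' : Measurable fun ω => (X ω, Y ω) := hXY.mono (hξ.sampleAlgebra_le S) le_rfl
  have hpair : Measurable fun ω => ((X ω, Y ω), ξ i.1 i.2.1 i.2.2 ω) :=
    hXY'.prodMk (hξ.measurable _ _ _)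
  have hm : Measurable fun y : (Vec d × Vec d) × Ξ =>
      (inner ℝ y.1.2 (Vt y.1.1 y.2 - V y.1.1) : ℝ) := by
    refine Measurable.inner (by fun_prop) (Measurable.sub ?_ (by fun_prop))
    exact ho.measurable.comp (by fun_prop : Measurable fun y : (Vec d × Vec d) × Ξ => (y.1.1, y.2))
  have hint := integrable_inner hY2 (memLp_queryNoise hV ho hξ hi hX)
  have hint' : Integrable (fun y : (Vec d × Vec d) × Ξ =>
      (inner ℝ y.1.2 (Vt y.1.1 y.2 - V y.1.1) : ℝ)) ((μ.map fun ω => (X ω, Y ω)).prod P) := by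
    rw [← hξ.map_prod hi hXY, integrable_map_measure hm.aestronglyMeasurable hpair.aemeasurable]
    exact hint
  have h1 : ∫ ω, inner ℝ (Y ω) (queryNoise V Vt ξ i X ω) ∂μ
      = ∫ y, (inner ℝ y.1.2 (Vt y.1.1 y.2 - V y.1.1) : ℝ)
          ∂((μ.map fun ω => (X ω, Y ω)).prod P) := by
    rw [← hξ.map_prod hi hXY, integral_map hpair.aemeasurable hm.aestronglyMeasurable]
    rfl
  rw [h1, integral_prod _ hint']
  refine integral_eq_zero_of_ae (Filter.Eventually.of_forall fun y => ?_)
  have hi' : Integrable (fun s => Vt y.1 s - V y.1) P := (ho.integrable y.1).sub (integrable_const _)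
  simp only [Pi.zero_apply]
  rw [integral_inner hi', integral_sub (ho.integrable y.1) (integrable_const _), ho.unbiased]
  simp

end FreshSamples

/-- The hypotheses under which the iterates are analyzed. -/
structure Setting {d : ℕ} {Ω Ξ : Type*} [MeasurableSpace Ω] [MeasurableSpace Ξ] {M : ℕ}
    (μ : Measure Ω) (P : Measure Ξ) (V : Vec d → Vec d) (Vt : Vec d → Ξ → Vec d)
    (ξ : ℕ → Fin M → ℕ → Ω → Ξ) (L G σ η : ℝ) : Prop where
  mono : MonotoneOp V
  smooth : SmoothOp L V
  bound : ∀ x, ‖V x‖ ≤ G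
  oracle : IsOracle V Vt P σ
  iid : IsIIDSample ξ P μ
  L_pos : 0 < L
  η_pos : 0 < η
  ηL_le : η * L ≤ 1
  M_pos : 0 < M

section Iterates

variable {d : ℕ} {Ω Ξ : Type*} [MeasurableSpace Ω] [MeasurableSpace Ξ] {M : ℕ}

/-- The iterate `z_t^m` as a random vector. -/
def iterZ (Vt : Vec d → Ξ → Vec d) (ξ : ℕ → Fin M → ℕ → Ω → Ξ) (L η : ℝ) (H K : ℕ)
    (t : ℕ) (m : Fin M) (ω : Ω) : Vec d :=
  lippaxZ Vt η (innerStepSize L η) H K (fun t m ℓ => ξ t m ℓ ω) t m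

/-- The inner iterate `x_{t+1,ℓ}^m` as a random vector. -/
def iterX (Vt : Vec d → Ξ → Vec d) (ξ : ℕ → Fin M → ℕ → Ω → Ξ) (L η : ℝ) (H K : ℕ)
    (t : ℕ) (m : Fin M) (ℓ : ℕ) (ω : Ω) : Vec d :=
  innerLoop Vt η (innerStepSize L η) (iterZ Vt ξ L η H K t m ω) (fun ℓ => ξ (t + 1) m ℓ ω) ℓ

/-- The noise of the query at `x_{t+1,ℓ}^m`. -/
def iterNoise (V : Vec d → Vec d) (Vt : Vec d → Ξ → Vec d) (ξ : ℕ → Fin M → ℕ → Ω → Ξ)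
    (L η : ℝ) (H K : ℕ) (t : ℕ) (m : Fin M) (ℓ : ℕ) : Ω → Vec d :=
  queryNoise V Vt ξ (t + 1, m, ℓ + 1) (iterX Vt ξ L η H K t m ℓ)

/-- The resolvent point of `z_t^m`. -/
def iterP (V : Vec d → Vec d) (Vt : Vec d → Ξ → Vec d) (ξ : ℕ → Fin M → ℕ → Ω → Ξ)
    (L η : ℝ) (H K : ℕ) (t : ℕ) (m : Fin M) (ω : Ω) : Vec d :=
  resolvent V η (iterZ Vt ξ L η H K t m ω)

/-- Indices of the samples used in the first `t` rounds and the first `ℓ` queries of the next. -/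
def pastIndices (M t ℓ : ℕ) : Set (ℕ × Fin M × ℕ) :=
  {j | j.1 ≤ t ∨ (j.1 = t + 1 ∧ j.2.2 ≤ ℓ)}

lemma pastIndices_mono {t ℓ ℓ' : ℕ} (h : ℓ ≤ ℓ') : pastIndices M t ℓ ⊆ pastIndices M t ℓ' := by
  rintro j (hj | ⟨hj, hl⟩)
  · exact Or.inl hj
  · exact Or.inr ⟨hj, hl.trans h⟩

lemma not_mem_pastIndices (t ℓ : ℕ) (m : Fin M) : (t + 1, m, ℓ + 1) ∉ pastIndices M t ℓ := by
  simp [pastIndices]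

lemma le_subset_pastIndices (t ℓ : ℕ) :
    {j : ℕ × Fin M × ℕ | j.1 ≤ t} ⊆ pastIndices M t ℓ := fun _ hj => Or.inl hj

lemma pastIndices_subset_le (t ℓ : ℕ) :
    pastIndices M t ℓ ⊆ {j : ℕ × Fin M × ℕ | j.1 ≤ t + 1} := by
  rintro j (hj | ⟨hj, -⟩)
  · exact Nat.le_succ_of_le hj
  · exact hj.le

variable {μ : Measure Ω} [IsProbabilityMeasure μ] {P : Measure Ξ} [IsProbabilityMeasure P]
  {V : Vec d → Vec d} {Vt : Vec d → Ξ → Vec d} {ξ : ℕ → Fin M → ℕ → Ω → Ξ} {L G σ η : ℝ}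

lemma iterX_zero (H K t : ℕ) (m : Fin M) :
    iterX Vt ξ L η H K t m 0 = iterZ Vt ξ L η H K t m := rfl

lemma iterX_succ (V : Vec d → Vec d) (H K t : ℕ) (m : Fin M) (ℓ : ℕ) (ω : Ω) :
    iterX Vt ξ L η H K t m (ℓ + 1) ω =
      iterX Vt ξ L η H K t m ℓ ω - innerStepSize L η •
        (V (iterX Vt ξ L η H K t m ℓ ω) + iterNoise V Vt ξ L η H K t m ℓ ω
          + (1 / η) • (iterX Vt ξ L η H K t m ℓ ω - iterZ Vt ξ L η H K t m ω)) := by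
  simp only [iterNoise, queryNoise, add_sub_cancel]
  rfl

/-- The value of `z_t^m` after the local step of the next round and before averaging. -/
def iterLocal (V : Vec d → Vec d) (Vt : Vec d → Ξ → Vec d) (ξ : ℕ → Fin M → ℕ → Ω → Ξ)
    (L η : ℝ) (H K : ℕ) (t : ℕ) (m : Fin M) (ω : Ω) : Vec d :=
  iterZ Vt ξ L η H K t m ω
    - η • (V (iterX Vt ξ L η H K t m H ω) + iterNoise V Vt ξ L η H K t m H ω)

lemma iterZ_succ (V : Vec d → Vec d) (H K t : ℕ) (m : Fin M) (ω : Ω) :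
    iterZ Vt ξ L η H K (t + 1) m ω =
      if (t + 1) % K = 0 then (1 / (M : ℝ)) • ∑ m' : Fin M, iterLocal V Vt ξ L η H K t m' ω
      else iterLocal V Vt ξ L η H K t m ω := by
  simp only [iterLocal, iterNoise, queryNoise, add_sub_cancel]
  rfl

namespace Setting

variable (h : Setting μ P V Vt ξ L G σ η)
include h

lemma continuous_V : Continuous V := continuous_of_smoothOp h.smooth h.L_pos.le

lemma measurable_V : Measurable V := h.continuous_V.measurable

lemma memLp_V {X : Ω → Vec d} (hX : Measurable X) : MemLp (fun ω => V (X ω)) 2 μ :=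
  MemLp.of_bound (h.measurable_V.comp hX).aestronglyMeasurable G
    (Filter.Eventually.of_forall fun _ => h.bound _)

lemma measurable_of_sample {S : Set (ℕ × Fin M × ℕ)} {β : Type*} [MeasurableSpace β] {Y : Ω → β}
    (hY : Measurable[sampleAlgebra ξ S] Y) : Measurable Y :=
  hY.mono (h.iid.sampleAlgebra_le S) le_rfl

lemma memLp_V_of_sample {S : Set (ℕ × Fin M × ℕ)} {X : Ω → Vec d}
    (hX : Measurable[sampleAlgebra ξ S] X) : MemLp (fun ω => V (X ω)) 2 μ :=
  h.memLp_V (h.measurable_of_sample hX)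

lemma iterX_sample_of_iterZ {H K t : ℕ} {m : Fin M}
    (hZ : Measurable[sampleAlgebra ξ {j | j.1 ≤ t}] (iterZ Vt ξ L η H K t m))
    (hZ2 : MemLp (iterZ Vt ξ L η H K t m) 2 μ) (ℓ : ℕ) :
    Measurable[sampleAlgebra ξ (pastIndices M t ℓ)] (iterX Vt ξ L η H K t m ℓ) ∧
      MemLp (iterX Vt ξ L η H K t m ℓ) 2 μ := by
  induction ℓ with
  | zero => exact ⟨hZ.mono (sampleAlgebra_mono (le_subset_pastIndices t 0)) le_rfl, hZ2⟩
  | succ ℓ ih =>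
    have e := funext fun ω => iterX_succ (Vt := Vt) (ξ := ξ) (L := L) (η := η) V H K t m ℓ ω
    have hX := ih.1.mono (sampleAlgebra_mono (pastIndices_mono ℓ.le_succ)) le_rfl
    have hn : Measurable[sampleAlgebra ξ (pastIndices M t (ℓ + 1))]
        (iterNoise V Vt ξ L η H K t m ℓ) :=
      measurable_queryNoise h.measurable_V h.oracle.measurable (Or.inr ⟨rfl, le_rfl⟩) hX
    have hn2 : MemLp (iterNoise V Vt ξ L η H K t m ℓ) 2 μ :=
      memLp_queryNoise h.measurable_V h.oracle h.iid (not_mem_pastIndices t ℓ m) ih.1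
    rw [e]
    constructor
    · exact hX.sub ((((h.measurable_V.comp hX).add hn).add ((hX.sub (hZ.mono
        (sampleAlgebra_mono (le_subset_pastIndices t _)) le_rfl)).const_smul (1 / η))).const_smul
          (innerStepSize L η))
    · exact ih.2.sub ((((h.memLp_V_of_sample ih.1).add hn2).add
        ((ih.2.sub hZ2).const_smul (1 / η))).const_smul (innerStepSize L η))

lemma iterZ_sample (H K t : ℕ) (m : Fin M) :
    Measurable[sampleAlgebra ξ {j | j.1 ≤ t}] (iterZ Vt ξ L η H K t m) ∧
      MemLp (iterZ Vt ξ L η H K t m) 2 μ := by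
  induction t generalizing m with
  | zero =>
    have e : iterZ Vt ξ L η H K 0 m = fun _ => 0 := rfl
    rw [e]
    exact ⟨measurable_const, memLp_const 0⟩
  | succ t ih =>
    have hloc : ∀ m, Measurable[sampleAlgebra ξ {j | j.1 ≤ t + 1}]
        (iterLocal V Vt ξ L η H K t m) ∧ MemLp (iterLocal V Vt ξ L η H K t m) 2 μ := by
      intro m
      obtain ⟨hX, hX2⟩ := h.iterX_sample_of_iterZ (ih m).1 (ih m).2 H
      have hX' := hX.mono (sampleAlgebra_mono (pastIndices_subset_le t H)) le_rfl
      have hn : Measurable[sampleAlgebra ξ {j | j.1 ≤ t + 1}]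
          (iterNoise V Vt ξ L η H K t m H) :=
        measurable_queryNoise h.measurable_V h.oracle.measurable (le_refl (t + 1)) hX'
      have hn2 : MemLp (iterNoise V Vt ξ L η H K t m H) 2 μ :=
        memLp_queryNoise h.measurable_V h.oracle h.iid (not_mem_pastIndices t H m) hX
      constructor
      · exact ((ih m).1.mono (sampleAlgebra_mono fun j hj => Nat.le_succ_of_le hj) le_rfl).sub
          (((h.measurable_V.comp hX').add hn).const_smul η)
      · exact (ih m).2.sub (((h.memLp_V_of_sample hX).add hn2).const_smul η)
    have e := funext fun ω => iterZ_succ (Vt := Vt) (ξ := ξ) (L := L) (η := η) V H K t m ω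
    rw [e]
    split_ifs
    · constructor
      · exact (Finset.measurable_fun_sum _ fun m' _ => (hloc m').1).const_smul (1 / (M : ℝ))
      · exact (memLp_finsetSum _ fun m' _ => (hloc m').2).const_smul (1 / (M : ℝ))
    · exact hloc m

lemma iterX_sample (H K t : ℕ) (m : Fin M) (ℓ : ℕ) :
    Measurable[sampleAlgebra ξ (pastIndices M t ℓ)] (iterX Vt ξ L η H K t m ℓ) :=
  (h.iterX_sample_of_iterZ (h.iterZ_sample H K t m).1 (h.iterZ_sample H K t m).2 ℓ).1

lemma iterZ_past (H K t : ℕ) (m : Fin M) (ℓ : ℕ) :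
    Measurable[sampleAlgebra ξ (pastIndices M t ℓ)] (iterZ Vt ξ L η H K t m) :=
  (h.iterZ_sample H K t m).1.mono (sampleAlgebra_mono (le_subset_pastIndices t ℓ)) le_rfl

lemma memLp_iterX (H K t : ℕ) (m : Fin M) (ℓ : ℕ) : MemLp (iterX Vt ξ L η H K t m ℓ) 2 μ :=
  (h.iterX_sample_of_iterZ (h.iterZ_sample H K t m).1 (h.iterZ_sample H K t m).2 ℓ).2

lemma memLp_iterZ (H K t : ℕ) (m : Fin M) : MemLp (iterZ Vt ξ L η H K t m) 2 μ :=
  (h.iterZ_sample H K t m).2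

lemma memLp_V_iterX (H K t : ℕ) (m : Fin M) (ℓ : ℕ) :
    MemLp (fun ω => V (iterX Vt ξ L η H K t m ℓ ω)) 2 μ :=
  h.memLp_V_of_sample (h.iterX_sample H K t m ℓ)

lemma memLp_iterNoise (H K t : ℕ) (m : Fin M) (ℓ : ℕ) :
    MemLp (iterNoise V Vt ξ L η H K t m ℓ) 2 μ :=
  memLp_queryNoise h.measurable_V h.oracle h.iid (not_mem_pastIndices t ℓ m)
    (h.iterX_sample H K t m ℓ)

lemma integral_iterNoise_sq_le (H K t : ℕ) (m : Fin M) (ℓ : ℕ) :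
    ∫ ω, ‖iterNoise V Vt ξ L η H K t m ℓ ω‖ ^ 2 ∂μ ≤ σ ^ 2 :=
  integral_queryNoise_sq_le h.measurable_V h.oracle h.iid (not_mem_pastIndices t ℓ m)
    (h.iterX_sample H K t m ℓ)

lemma integral_inner_iterNoise {H K t : ℕ} {m : Fin M} {ℓ : ℕ} {Y : Ω → Vec d}
    (hY : Measurable[sampleAlgebra ξ (pastIndices M t ℓ)] Y) (hY2 : MemLp Y 2 μ) :
    ∫ ω, inner ℝ (Y ω) (iterNoise V Vt ξ L η H K t m ℓ ω) ∂μ = 0 :=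
  integral_inner_queryNoise h.measurable_V h.oracle h.iid (not_mem_pastIndices t ℓ m)
    (h.iterX_sample H K t m ℓ) hY hY2

/-- The noises of the last queries of different machines or rounds are orthogonal. -/
lemma integral_inner_iterNoise_iterNoise {H K t t' : ℕ} {m m' : Fin M}
    (hne : (t, m) ≠ (t', m')) :
    ∫ ω, inner ℝ (iterNoise V Vt ξ L η H K t m H ω) (iterNoise V Vt ξ L η H K t' m' H ω) ∂μ
      = 0 := by
  have key : ∀ {t t' : ℕ} {m m' : Fin M}, (t, m) ≠ (t', m') → t ≤ t' →
      ∫ ω, inner ℝ (iterNoise V Vt ξ L η H K t m H ω)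
        (iterNoise V Vt ξ L η H K t' m' H ω) ∂μ = 0 := by
    intro t t' m m' hne hle
    have hsub : pastIndices M t H ⊆ {(t' + 1, m', H + 1)}ᶜ := by
      rintro ⟨a, b, c⟩ hj hj'
      simp only [Set.mem_singleton_iff, Prod.mk.injEq] at hj'
      simp only [pastIndices, Set.mem_ofPred_eq] at hj
      omega
    have hmem : (t + 1, m, H + 1) ∈ ({(t' + 1, m', H + 1)}ᶜ : Set (ℕ × Fin M × ℕ)) := by
      intro hj
      apply hne
      simpa using hj
    have hsub' : pastIndices M t' H ⊆ {(t' + 1, m', H + 1)}ᶜ :=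
      Set.subset_compl_singleton_iff.2 (not_mem_pastIndices t' H m')
    exact integral_inner_queryNoise h.measurable_V h.oracle h.iid
      (S := {(t' + 1, m', H + 1)}ᶜ) (by simp)
      ((h.iterX_sample H K t' m' H).mono (sampleAlgebra_mono hsub') le_rfl)
      (measurable_queryNoise h.measurable_V h.oracle.measurable hmem
        ((h.iterX_sample H K t m H).mono (sampleAlgebra_mono hsub) le_rfl))
      (h.memLp_iterNoise H K t m H)
  rcases le_total t t' with hle | hle
  · exact key hne hle
  · rw [← key hne.symm hle]
    exact integral_congr_ae (Filter.Eventually.of_forall fun ω => real_inner_comm _ _)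

lemma iterP_spec (H K t : ℕ) (m : Fin M) (ω : Ω) :
    iterP V Vt ξ L η H K t m ω + η • V (iterP V Vt ξ L η H K t m ω)
      = iterZ Vt ξ L η H K t m ω :=
  resolvent_spec h.mono h.smooth h.L_pos.le h.η_pos _

lemma iterP_past (H K t : ℕ) (m : Fin M) (ℓ : ℕ) :
    Measurable[sampleAlgebra ξ (pastIndices M t ℓ)] (iterP V Vt ξ L η H K t m) :=
  (continuous_resolvent h.mono h.smooth h.L_pos.le h.η_pos).measurable.comp
    (h.iterZ_past H K t m ℓ)

lemma memLp_iterP (H K t : ℕ) (m : Fin M) : MemLp (iterP V Vt ξ L η H K t m) 2 μ := by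
  have e : iterP V Vt ξ L η H K t m = fun ω => iterZ Vt ξ L η H K t m ω
      - η • V (iterP V Vt ξ L η H K t m ω) := funext fun ω =>
    eq_sub_of_add_eq (h.iterP_spec H K t m ω)
  rw [e]
  exact (h.memLp_iterZ H K t m).sub
    ((h.memLp_V_of_sample (h.iterP_past H K t m 0)).const_smul η)

lemma norm_iterZ_sub_iterP_le (H K t : ℕ) (m : Fin M) (ω : Ω) :
    ‖iterZ Vt ξ L η H K t m ω - iterP V Vt ξ L η H K t m ω‖ ≤ η * G := by
  rw [← h.iterP_spec H K t m ω, add_sub_cancel_left, norm_smul, Real.norm_of_nonneg h.η_pos.le]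
  exact mul_le_mul_of_nonneg_left (h.bound _) h.η_pos.le

end Setting

end Iterates

section InnerLoop

variable {d : ℕ} {Ω Ξ : Type*} [MeasurableSpace Ω] [MeasurableSpace Ξ] {M : ℕ}
  {μ : Measure Ω} [IsProbabilityMeasure μ] {P : Measure Ξ} [IsProbabilityMeasure P]
  {V : Vec d → Vec d} {Vt : Vec d → Ξ → Vec d} {ξ : ℕ → Fin M → ℕ → Ω → Ξ} {L G σ η : ℝ}

/-- The noiseless part of `x_{t+1,ℓ+1}^m - p`, where `p` is the resolvent point of `z_t^m`. -/
def iterDrift (V : Vec d → Vec d) (Vt : Vec d → Ξ → Vec d) (ξ : ℕ → Fin M → ℕ → Ω → Ξ)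
    (L η : ℝ) (H K : ℕ) (t : ℕ) (m : Fin M) (ℓ : ℕ) (ω : Ω) : Vec d :=
  (1 - 1 / (1 + η * L) ^ 2) • (iterX Vt ξ L η H K t m ℓ ω - iterP V Vt ξ L η H K t m ω)
    - (η * (1 / (1 + η * L) ^ 2)) •
      (V (iterX Vt ξ L η H K t m ℓ ω) - V (iterP V Vt ξ L η H K t m ω))

/-- Mean squared length of the resolvent step at `z_t^m`. -/
def resolventStep (μ : Measure Ω) (V : Vec d → Vec d) (Vt : Vec d → Ξ → Vec d)
    (ξ : ℕ → Fin M → ℕ → Ω → Ξ) (L η : ℝ) (H K : ℕ) (t : ℕ) (m : Fin M) : ℝ :=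
  ∫ ω, ‖iterZ Vt ξ L η H K t m ω - iterP V Vt ξ L η H K t m ω‖ ^ 2 ∂μ

lemma resolventStep_nonneg (H K t : ℕ) (m : Fin M) : 0 ≤ resolventStep μ V Vt ξ L η H K t m :=
  integral_nonneg fun _ => by positivity

namespace Setting

variable (h : Setting μ P V Vt ξ L G σ η)
include h

lemma ηL_pos : 0 < η * L := mul_pos h.η_pos h.L_pos

lemma resolventStep_le (H K t : ℕ) (m : Fin M) :
    resolventStep μ V Vt ξ L η H K t m ≤ η ^ 2 * G ^ 2 := by
  have hi := integrable_norm_sq ((h.memLp_iterZ H K t m).sub (h.memLp_iterP H K t m))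
  calc _ ≤ ∫ _, (η * G) ^ 2 ∂μ := integral_mono hi (integrable_const _) fun ω =>
        pow_le_pow_left₀ (norm_nonneg _) (h.norm_iterZ_sub_iterP_le H K t m ω) 2
    _ = _ := by simp [mul_pow]

lemma iterX_succ_sub_iterP (H K t : ℕ) (m : Fin M) (ℓ : ℕ) (ω : Ω) :
    iterX Vt ξ L η H K t m (ℓ + 1) ω - iterP V Vt ξ L η H K t m ω =
      iterDrift V Vt ξ L η H K t m ℓ ω
        - (η * (1 / (1 + η * L) ^ 2)) • iterNoise V Vt ξ L η H K t m ℓ ω := by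
  rw [iterX_succ V, innerStepSize_eq h.η_pos, ← h.iterP_spec H K t m ω, iterDrift]
  generalize 1 / (1 + η * L) ^ 2 = c
  have hη := h.η_pos.ne'
  set x := iterX Vt ξ L η H K t m ℓ ω
  set p := iterP V Vt ξ L η H K t m ω
  set n := iterNoise V Vt ξ L η H K t m ℓ ω
  have e : (1 / η) • (x - (p + η • V p)) = (1 / η) • (x - p) - V p := by
    rw [← sub_sub, smul_sub, smul_smul, one_div_mul_cancel hη, one_smul]
  have e2 : (η * c) • ((1 / η) • (x - p)) = c • (x - p) := by
    rw [smul_smul]; congr 1; field_simp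
  rw [e, smul_add, smul_sub (η * c) ((1 / η) • (x - p)), e2]
  module

lemma iterDrift_past (H K t : ℕ) (m : Fin M) (ℓ : ℕ) :
    Measurable[sampleAlgebra ξ (pastIndices M t ℓ)] (iterDrift V Vt ξ L η H K t m ℓ) := by
  have hX := h.iterX_sample H K t m ℓ
  have hP := h.iterP_past H K t m ℓ
  exact ((hX.sub hP).const_smul (1 - 1 / (1 + η * L) ^ 2)).sub
    (((h.measurable_V.comp hX).sub (h.measurable_V.comp hP)).const_smul
      (η * (1 / (1 + η * L) ^ 2)))

lemma memLp_iterX_sub_iterP (H K t : ℕ) (m : Fin M) (ℓ : ℕ) :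
    MemLp (fun ω => iterX Vt ξ L η H K t m ℓ ω - iterP V Vt ξ L η H K t m ω) 2 μ :=
  (h.memLp_iterX H K t m ℓ).sub (h.memLp_iterP H K t m)

lemma memLp_iterZ_sub_iterP (H K t : ℕ) (m : Fin M) :
    MemLp (fun ω => iterZ Vt ξ L η H K t m ω - iterP V Vt ξ L η H K t m ω) 2 μ :=
  (h.memLp_iterZ H K t m).sub (h.memLp_iterP H K t m)

lemma memLp_iterX_sub_iterZ (H K t : ℕ) (m : Fin M) :
    MemLp (fun ω => iterX Vt ξ L η H K t m H ω - iterZ Vt ξ L η H K t m ω) 2 μ :=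
  (h.memLp_iterX H K t m H).sub (h.memLp_iterZ H K t m)

lemma memLp_iterDrift (H K t : ℕ) (m : Fin M) (ℓ : ℕ) :
    MemLp (iterDrift V Vt ξ L η H K t m ℓ) 2 μ := by
  unfold iterDrift
  have h1 := (h.memLp_iterX_sub_iterP H K t m ℓ).const_smul (1 - 1 / (1 + η * L) ^ 2)
  have h2 : MemLp (fun ω => V (iterX Vt ξ L η H K t m ℓ ω) - V (iterP V Vt ξ L η H K t m ω)) 2 μ :=
    (h.memLp_V_iterX H K t m ℓ).sub (h.memLp_V_of_sample (h.iterP_past H K t m 0))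
  exact h1.sub (h2.const_smul (η * (1 / (1 + η * L) ^ 2)))

lemma norm_iterDrift_sq_le (H K t : ℕ) (m : Fin M) (ℓ : ℕ) (ω : Ω) :
    ‖iterDrift V Vt ξ L η H K t m ℓ ω‖ ^ 2 ≤ contractionFactor (η * L) *
      ‖iterX Vt ξ L η H K t m ℓ ω - iterP V Vt ξ L η H K t m ω‖ ^ 2 :=
  norm_sq_innerStep_le h.mono h.smooth h.L_pos.le h.η_pos _ _

lemma integrable_dist_sq (H K t : ℕ) (m : Fin M) (ℓ : ℕ) :
    Integrable (fun ω => ‖iterX Vt ξ L η H K t m ℓ ω - iterP V Vt ξ L η H K t m ω‖ ^ 2) μ :=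
  integrable_norm_sq (h.memLp_iterX_sub_iterP H K t m ℓ)

lemma integral_dist_sq_succ_le (H K t : ℕ) (m : Fin M) (ℓ : ℕ) :
    ∫ ω, ‖iterX Vt ξ L η H K t m (ℓ + 1) ω - iterP V Vt ξ L η H K t m ω‖ ^ 2 ∂μ ≤
      contractionFactor (η * L) *
        ∫ ω, ‖iterX Vt ξ L η H K t m ℓ ω - iterP V Vt ξ L η H K t m ω‖ ^ 2 ∂μ
        + (η * (1 / (1 + η * L) ^ 2)) ^ 2 * σ ^ 2 := by
  simp_rw [h.iterX_succ_sub_iterP]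
  rw [integral_norm_sub_smul_sq (h.memLp_iterDrift H K t m ℓ) (h.memLp_iterNoise H K t m ℓ)
    (h.integral_inner_iterNoise (h.iterDrift_past H K t m ℓ) (h.memLp_iterDrift H K t m ℓ)),
    ← integral_const_mul (contractionFactor (η * L))]
  exact add_le_add (integral_mono (integrable_norm_sq (h.memLp_iterDrift H K t m ℓ))
    ((h.integrable_dist_sq H K t m ℓ).const_mul _) (h.norm_iterDrift_sq_le H K t m ℓ))
    (mul_le_mul_of_nonneg_left (h.integral_iterNoise_sq_le H K t m ℓ) (sq_nonneg _))

/-- The inner loop approximates the resolvent up to the noise level. -/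
lemma integral_dist_sq_le (H K t : ℕ) (m : Fin M) (ℓ : ℕ) :
    ∫ ω, ‖iterX Vt ξ L η H K t m ℓ ω - iterP V Vt ξ L η H K t m ω‖ ^ 2 ∂μ ≤
      contractionFactor (η * L) ^ ℓ * resolventStep μ V Vt ξ L η H K t m + η ^ 2 * σ ^ 2 := by
  have hc0 := ratio_nonneg (η * L)
  have hc1 := ratio_le_one h.ηL_pos.le
  have hq0 := contractionFactor_nonneg (η * L)
  have hq1 := contractionFactor_le_one_sub h.ηL_pos.le
  have hs := h.integral_dist_sq_succ_le H K t m
  set c := 1 / (1 + η * L) ^ 2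
  set q := contractionFactor (η * L)
  have hN : 0 ≤ η ^ 2 * σ ^ 2 := by positivity
  have key : ∫ ω, ‖iterX Vt ξ L η H K t m ℓ ω - iterP V Vt ξ L η H K t m ω‖ ^ 2 ∂μ ≤
      q ^ ℓ * resolventStep μ V Vt ξ L η H K t m + c * (η ^ 2 * σ ^ 2) := by
    induction ℓ with
    | zero =>
      simp only [iterX_zero, pow_zero, one_mul]
      exact le_add_of_nonneg_right (by positivity)
    | succ ℓ ih =>
      have h1 := mul_le_mul_of_nonneg_left ih hq0
      have h2 : (q + c - 1) * (c * (η ^ 2 * σ ^ 2)) ≤ 0 :=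
        mul_nonpos_of_nonpos_of_nonneg (by linarith) (by positivity)
      have := hs ℓ
      rw [pow_succ]
      nlinarith
  nlinarith

lemma contractionFactor_le_one : contractionFactor (η * L) ≤ 1 := by
  linarith [contractionFactor_le_one_sub h.ηL_pos.le, ratio_nonneg (η * L)]

lemma integral_dist_sq_le' (H K t : ℕ) (m : Fin M) (ℓ : ℕ) :
    ∫ ω, ‖iterX Vt ξ L η H K t m ℓ ω - iterP V Vt ξ L η H K t m ω‖ ^ 2 ∂μ ≤
      resolventStep μ V Vt ξ L η H K t m + η ^ 2 * σ ^ 2 := by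
  have h1 := h.integral_dist_sq_le H K t m ℓ
  have h2 : contractionFactor (η * L) ^ ℓ ≤ 1 :=
    pow_le_one₀ (contractionFactor_nonneg _) h.contractionFactor_le_one
  nlinarith [resolventStep_nonneg (μ := μ) (V := V) (Vt := Vt) (ξ := ξ) (L := L) (η := η) H K t m]

lemma integral_iterX_sub_iterZ_sq_le (H K t : ℕ) (m : Fin M) :
    ∫ ω, ‖iterX Vt ξ L η H K t m H ω - iterZ Vt ξ L η H K t m ω‖ ^ 2 ∂μ ≤
      4 * resolventStep μ V Vt ξ L η H K t m + 2 * (η ^ 2 * σ ^ 2) := by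
  have hXP := h.integrable_dist_sq H K t m H
  have hZP := integrable_norm_sq (h.memLp_iterZ_sub_iterP H K t m)
  have hXZ := integrable_norm_sq (h.memLp_iterX_sub_iterZ H K t m)
  calc _ ≤ ∫ ω, (2 * ‖iterX Vt ξ L η H K t m H ω - iterP V Vt ξ L η H K t m ω‖ ^ 2
        + 2 * ‖iterZ Vt ξ L η H K t m ω - iterP V Vt ξ L η H K t m ω‖ ^ 2) ∂μ := by
        refine integral_mono hXZ ((hXP.const_mul _).add (hZP.const_mul _)) fun ω => ?_
        set x := iterX Vt ξ L η H K t m H ω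
        set z := iterZ Vt ξ L η H K t m ω
        set p := iterP V Vt ξ L η H K t m ω
        have e : x - z = (x - p) - (z - p) := by abel
        have := norm_sub_le (x - p) (z - p)
        rw [e]
        nlinarith [norm_nonneg ((x - p) - (z - p)), sq_nonneg (‖x - p‖ - ‖z - p‖)]
    _ ≤ _ := by
        rw [integral_add (hXP.const_mul _) (hZP.const_mul _), integral_const_mul,
          integral_const_mul]
        have := h.integral_dist_sq_le' H K t m H
        unfold resolventStep at *
        linarith

/-- The progress term of round `t + 1` on machine `m`. -/
def iterProgress (V : Vec d → Vec d) (Vt : Vec d → Ξ → Vec d) (ξ : ℕ → Fin M → ℕ → Ω → Ξ)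
    (L η : ℝ) (H K : ℕ) (t : ℕ) (m : Fin M) (ω : Ω) : ℝ :=
  2 * η * inner ℝ (V (iterX Vt ξ L η H K t m H ω))
      (iterX Vt ξ L η H K t m H ω - iterZ Vt ξ L η H K t m ω)
    + η ^ 2 * ‖V (iterX Vt ξ L η H K t m H ω)‖ ^ 2

lemma integrable_iterProgress (H K t : ℕ) (m : Fin M) :
    Integrable (iterProgress V Vt ξ L η H K t m) μ :=
  ((integrable_inner (h.memLp_V_iterX H K t m H)
    ((h.memLp_iterX H K t m H).sub (h.memLp_iterZ H K t m))).const_mul _).add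
    ((integrable_norm_sq (h.memLp_V_iterX H K t m H)).const_mul _)

/-- Progress bound that holds for all step sizes. -/
lemma integral_iterProgress_le (H K t : ℕ) (m : Fin M) :
    ∫ ω, iterProgress V Vt ξ L η H K t m ω ∂μ ≤
      5 * (η ^ 2 * σ ^ 2) + 360 * (η ^ 2 * G ^ 2) / 4 ^ H := by
  have hXP := h.integrable_dist_sq H K t m H
  have hZP := integrable_norm_sq (h.memLp_iterZ_sub_iterP H K t m)
  have h1 : ∫ ω, iterProgress V Vt ξ L η H K t m ω ∂μ ≤
      ∫ ω, (5 * ‖iterX Vt ξ L η H K t m H ω - iterP V Vt ξ L η H K t m ω‖ ^ 2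
        - 1 / 2 * ‖iterZ Vt ξ L η H K t m ω - iterP V Vt ξ L η H K t m ω‖ ^ 2) ∂μ := by
    refine integral_mono (h.integrable_iterProgress H K t m)
      ((hXP.const_mul _).sub (hZP.const_mul _)) fun ω => ?_
    have hp := progress_le h.smooth h.η_pos (x := iterX Vt ξ L η H K t m H ω)
      (h.iterP_spec H K t m ω)
    have ha := h.ηL_pos
    have ha1 := h.ηL_le
    simp only [iterProgress]
    set x := iterX Vt ξ L η H K t m H ω
    set z := iterZ Vt ξ L η H K t m ω
    set p := iterP V Vt ξ L η H K t m ω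
    have h2 := real_inner_le_norm (z - p) (x - p)
    have h3 : (2 * (η * L) + (η * L) ^ 2) * ‖x - p‖ ^ 2 ≤ 3 * ‖x - p‖ ^ 2 :=
      mul_le_mul_of_nonneg_right (by nlinarith) (sq_nonneg _)
    nlinarith [sq_nonneg (‖z - p‖ - 2 * ‖x - p‖)]
  rw [integral_sub (hXP.const_mul _) (hZP.const_mul _), integral_const_mul,
    integral_const_mul] at h1
  have h2 := h.integral_dist_sq_le H K t m H
  have h3 := h.resolventStep_le H K t m
  have h0 := resolventStep_nonneg (μ := μ) (V := V) (Vt := Vt) (ξ := ξ) (L := L) (η := η) H K t m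
  have hq : contractionFactor (η * L) ^ H ≤ (5 / 8) ^ H :=
    pow_le_pow_left₀ (contractionFactor_nonneg _) (contractionFactor_le h.ηL_pos.le h.ηL_le) H
  have h4 : ∫ ω, iterProgress V Vt ξ L η H K t m ω ∂μ ≤ 5 * (η ^ 2 * σ ^ 2) +
      (5 * (5 / 8) ^ H - 1 / 2) * resolventStep μ V Vt ξ L η H K t m := by
    have := mul_le_mul_of_nonneg_right hq h0
    simp only [resolventStep] at *
    linarith
  refine h4.trans (add_le_add_right ?_ _)
  rcases le_or_gt 5 H with hH | hH
  · have h5 : (5 / 8 : ℝ) ^ H ≤ (5 / 8) ^ 5 :=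
      pow_le_pow_of_le_one (by norm_num) (by norm_num) hH
    have h6 : (0 : ℝ) ≤ 360 * (η ^ 2 * G ^ 2) / 4 ^ H := by positivity
    refine le_trans (mul_nonpos_of_nonpos_of_nonneg ?_ h0) h6
    norm_num at h5 ⊢
    linarith
  · have h5 : (5 * (5 / 8) ^ H - 1 / 2) ≤ (360 : ℝ) / 4 ^ H := by
      interval_cases H <;> norm_num
    calc _ ≤ (360 : ℝ) / 4 ^ H * resolventStep μ V Vt ξ L η H K t m :=
          mul_le_mul_of_nonneg_right h5 h0
      _ ≤ 360 / 4 ^ H * (η ^ 2 * G ^ 2) := mul_le_mul_of_nonneg_left h3 (by positivity)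
      _ = _ := by ring

/-- Progress bound for small step sizes. -/
lemma integral_iterProgress_le_of_small (H K t : ℕ) (m : Fin M) :
    ∫ ω, iterProgress V Vt ξ L η H K t m ω ∂μ ≤
      -(1 - 8 * (η * L)) * resolventStep μ V Vt ξ L η H K t m + 5 * (η * L) * (η ^ 2 * σ ^ 2)
        + 2 * (η ^ 2 * G ^ 2) / 4 ^ H := by
  have ha := h.ηL_pos
  have ha1 := h.ηL_le
  have hR := h.resolventStep_le H K t m
  have h0 := resolventStep_nonneg (μ := μ) (V := V) (Vt := Vt) (ξ := ξ) (L := L) (η := η) H K t m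
  cases H with
  | zero =>
    have h1 : ∫ ω, iterProgress V Vt ξ L η 0 K t m ω ∂μ ≤ ∫ _, η ^ 2 * G ^ 2 ∂μ := by
      refine integral_mono (h.integrable_iterProgress 0 K t m) (integrable_const _) fun ω => ?_
      simp only [iterProgress, iterX_zero, sub_self, inner_zero_right, mul_zero, zero_add]
      exact mul_le_mul_of_nonneg_left (pow_le_pow_left₀ (norm_nonneg _) (h.bound _) 2)
        (sq_nonneg η)
    simp only [integral_const, probReal_univ, one_smul] at h1
    have : 0 ≤ 5 * (η * L) * (η ^ 2 * σ ^ 2) := by positivity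
    simp only [pow_zero, div_one]
    nlinarith
  | succ k =>
    set H := k + 1 with hH
    have hXP := h.integrable_dist_sq H K t m H
    have hXk := h.integrable_dist_sq H K t m k
    have hZP2 := h.memLp_iterZ_sub_iterP H K t m
    have hZP := integrable_norm_sq hZP2
    have hno := integrable_inner hZP2 (h.memLp_iterNoise H K t m k)
    have hno0 := h.integral_inner_iterNoise (m := m) (ℓ := k) (H := H) (K := K)
      ((h.iterZ_past H K t m k).sub (h.iterP_past H K t m k)) hZP2
    have hm := ((MeanLe.of_integral hZP (-(1 - 3 * (η * L)))).add
      ((MeanLe.mk hXk (h.integral_dist_sq_le' H K t m k)).const_mul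
        (by positivity : 0 ≤ 2 * (η * L)))).add
      (((MeanLe.mk hXP (h.integral_dist_sq_le' H K t m H)).const_mul
        (by positivity : 0 ≤ 3 * (η * L))).add
      (MeanLe.of_integral_eq_zero hno hno0 (-(2 * (η * (1 / (1 + η * L) ^ 2))))))
    refine (hm.mono (h.integrable_iterProgress H K t m) (fun ω => ?_) ?_).le
    · have hp := progress_le h.smooth h.η_pos (x := iterX Vt ξ L η H K t m H ω)
        (h.iterP_spec H K t m ω)
      have hd := h.norm_iterDrift_sq_le H K t m k ω
      have hq := contractionFactor_le_five_mul_sq ha.le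
      have hx : inner ℝ (iterZ Vt ξ L η H K t m ω - iterP V Vt ξ L η H K t m ω)
          (iterX Vt ξ L η H K t m H ω - iterP V Vt ξ L η H K t m ω) =
          inner ℝ (iterZ Vt ξ L η H K t m ω - iterP V Vt ξ L η H K t m ω)
            (iterDrift V Vt ξ L η H K t m k ω) - (η * (1 / (1 + η * L) ^ 2)) *
          inner ℝ (iterZ Vt ξ L η H K t m ω - iterP V Vt ξ L η H K t m ω)
            (iterNoise V Vt ξ L η H K t m k ω) := by
        rw [h.iterX_succ_sub_iterP H K t m k ω, inner_sub_right, inner_smul_right]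
      simp only [iterProgress]
      set x := iterX Vt ξ L η H K t m H ω
      set y := iterX Vt ξ L η H K t m k ω
      set z := iterZ Vt ξ L η H K t m ω
      set p := iterP V Vt ξ L η H K t m ω
      set A := iterDrift V Vt ξ L η H K t m k ω
      set a := η * L
      have h2 := real_inner_le_norm (z - p) A
      have h3 : (2 * a + a ^ 2) * ‖x - p‖ ^ 2 ≤ 3 * a * ‖x - p‖ ^ 2 :=
        mul_le_mul_of_nonneg_right (by nlinarith) (sq_nonneg _)
      have h4 : ‖A‖ ^ 2 ≤ (6 * a ^ 2) * ‖y - p‖ ^ 2 :=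
        hd.trans (mul_le_mul_of_nonneg_right (by nlinarith) (sq_nonneg _))
      have h5 : 2 * (‖z - p‖ * ‖A‖) ≤ 3 * a * ‖z - p‖ ^ 2 + 2 * a * ‖y - p‖ ^ 2 := by
        have h6 : 0 ≤ (3 * a * ‖z - p‖ - ‖A‖) ^ 2 := sq_nonneg _
        have h7 : 3 * a * (2 * (‖z - p‖ * ‖A‖)) ≤
            3 * a * (3 * a * ‖z - p‖ ^ 2 + 2 * a * ‖y - p‖ ^ 2) := by nlinarith
        exact le_of_mul_le_mul_left h7 (by positivity)
      nlinarith
    · have hG : 0 ≤ 2 * (η ^ 2 * G ^ 2) / 4 ^ H := by positivity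
      simp only [resolventStep]
      linarith

end Setting

end InnerLoop

section Average

variable {d M : ℕ}

/-- The average over the machines. -/
def avg (y : Fin M → Vec d) : Vec d := (1 / (M : ℝ)) • ∑ m, y m

lemma smul_avg (hM : 0 < M) (y : Fin M → Vec d) : (M : ℝ) • avg y = ∑ m, y m := by
  have : (M : ℝ) ≠ 0 := by positivity
  rw [avg, smul_smul, mul_one_div_cancel this, one_smul]

lemma sum_norm_sub_sq (hM : 0 < M) (y : Fin M → Vec d) (w : Vec d) :
    ∑ m, ‖y m - w‖ ^ 2 = ∑ m, ‖y m - avg y‖ ^ 2 + M * ‖avg y - w‖ ^ 2 := by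
  have e : ∀ m, ‖y m - w‖ ^ 2
      = ‖y m - avg y‖ ^ 2 + 2 * inner ℝ (y m - avg y) (avg y - w) + ‖avg y - w‖ ^ 2 := fun m => by
    rw [← norm_add_sq_real, sub_add_sub_cancel]
  have h0 : ∑ m, (y m - avg y) = 0 := by
    simp [Finset.sum_sub_distrib, ← smul_avg hM y, ← Nat.cast_smul_eq_nsmul ℝ]
  simp_rw [e]
  rw [Finset.sum_add_distrib, Finset.sum_add_distrib, ← Finset.mul_sum, ← sum_inner, h0]
  simp

lemma sum_norm_sub_avg_sq_le (hM : 0 < M) (y : Fin M → Vec d) (w : Vec d) :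
    ∑ m, ‖y m - avg y‖ ^ 2 ≤ ∑ m, ‖y m - w‖ ^ 2 := by
  rw [sum_norm_sub_sq hM y w]
  exact le_add_of_nonneg_right (by positivity)

lemma mul_norm_avg_sub_sq_le (hM : 0 < M) (y : Fin M → Vec d) (w : Vec d) :
    M * ‖avg y - w‖ ^ 2 ≤ ∑ m, ‖y m - w‖ ^ 2 := by
  rw [sum_norm_sub_sq hM y w]
  exact le_add_of_nonneg_left (by positivity)

lemma norm_sum_sq_le (hM : 0 < M) (y : Fin M → Vec d) :
    ‖∑ m, y m‖ ^ 2 ≤ M * ∑ m, ‖y m‖ ^ 2 := by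
  have h := mul_norm_avg_sub_sq_le hM y 0
  simp only [sub_zero] at h
  rw [← smul_avg hM, norm_smul, mul_pow, Real.norm_natCast, sq, mul_assoc]
  exact mul_le_mul_of_nonneg_left h (Nat.cast_nonneg M)

end Average

section Gap

variable {d : ℕ} {V : Vec d → Vec d} {G D : ℝ}

lemma inner_le_mul_add (hG : ∀ x, ‖V x‖ ≤ G) (x : Vec d)
    (z : Metric.closedBall (0 : Vec d) D) :
    inner ℝ (V z) (x - z) ≤ G * (‖x‖ + D) := by
  have hz : ‖(z : Vec d)‖ ≤ D := mem_closedBall_zero_iff.1 z.2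
  have h0 : 0 ≤ G := (norm_nonneg _).trans (hG 0)
  calc _ ≤ ‖V z‖ * ‖x - z‖ := real_inner_le_norm _ _
    _ ≤ G * (‖x‖ + D) := mul_le_mul (hG _) ((norm_sub_le _ _).trans (by linarith))
        (norm_nonneg _) h0

lemma bddAbove_gap (hG : ∀ x, ‖V x‖ ≤ G) (x : Vec d) :
    BddAbove (Set.range fun z : Metric.closedBall (0 : Vec d) D => inner ℝ (V z) (x - z)) :=
  ⟨G * (‖x‖ + D), by rintro _ ⟨z, rfl⟩; exact inner_le_mul_add hG x z⟩

lemma gap_le (hD : 0 ≤ D) {x : Vec d} {B : ℝ}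
    (h : ∀ w : Vec d, ‖w‖ ≤ D → inner ℝ (V w) (x - w) ≤ B) : gap V D x ≤ B := by
  have : Nonempty (Metric.closedBall (0 : Vec d) D) := ⟨⟨0, by simpa using hD⟩⟩
  exact ciSup_le fun z => h z (mem_closedBall_zero_iff.1 z.2)

lemma lipschitzWith_gap (hG : ∀ x, ‖V x‖ ≤ G) (hD : 0 ≤ D) :
    LipschitzWith G.toNNReal (gap V D) := by
  have h0 : 0 ≤ G := (norm_nonneg _).trans (hG 0)
  refine LipschitzWith.of_le_add_mul _ fun x y => gap_le hD fun w hw => ?_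
  have h1 : inner ℝ (V w) (y - w) ≤ gap V D y :=
    le_ciSup (bddAbove_gap hG y) (⟨w, mem_closedBall_zero_iff.2 hw⟩ : Metric.closedBall _ D)
  have h2 : inner ℝ (V w) (x - y) ≤ G * ‖x - y‖ :=
    (real_inner_le_norm _ _).trans (mul_le_mul_of_nonneg_right (hG w) (norm_nonneg _))
  rw [Real.coe_toNNReal _ h0, dist_eq_norm, ← sub_add_sub_cancel x y w, inner_add_right]
  linarith

lemma integrable_gap {Ω : Type*} [MeasurableSpace Ω] {μ : Measure Ω} [IsProbabilityMeasure μ]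
    (hG : ∀ x, ‖V x‖ ≤ G) (hD : 0 ≤ D) {X : Ω → Vec d} (hX : Integrable X μ) :
    Integrable (fun ω => gap V D (X ω)) μ := by
  have h0 : 0 ≤ G := (norm_nonneg _).trans (hG 0)
  have hl := lipschitzWith_gap hG hD
  refine (((integrable_const |gap V D 0|).add (hX.norm.const_mul G))).mono'
    (hl.continuous.comp_aestronglyMeasurable hX.1) (Filter.Eventually.of_forall fun ω => ?_)
  have h1 := hl.dist_le_mul (X ω) 0
  rw [Real.dist_eq, dist_zero_right, Real.coe_toNNReal _ h0] at h1
  have h2 := abs_sub_abs_le_abs_sub (gap V D (X ω)) (gap V D 0)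
  simp only [Pi.add_apply, Real.norm_eq_abs]
  linarith

end Gap

section Regret

variable {d : ℕ} {Ω Ξ : Type*} [MeasurableSpace Ω] [MeasurableSpace Ξ] {M : ℕ}
  {μ : Measure Ω} [IsProbabilityMeasure μ] {P : Measure Ξ} [IsProbabilityMeasure P]
  {V : Vec d → Vec d} {Vt : Vec d → Ξ → Vec d} {ξ : ℕ → Fin M → ℕ → Ω → Ξ} {L G σ η : ℝ}

lemma lippaxOutput_eq (H K T : ℕ) (ω : Ω) :
    lippaxOutput Vt η (innerStepSize L η) H K T (fun t m ℓ => ξ t m ℓ ω) =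
      (1 / ((M : ℝ) * T)) • ∑ t ∈ Finset.range T, ∑ m, iterX Vt ξ L η H K t m H ω := by
  unfold lippaxOutput
  rw [Finset.sum_comm, Finset.range_eq_Ico]
  congr 1
  exact (Finset.sum_Ico_add' (fun t => ∑ m, lippaxX Vt η (innerStepSize L η) H K
    (fun t m ℓ => ξ t m ℓ ω) t m) 0 T 1).symm

namespace Setting

variable (h : Setting μ P V Vt ξ L G σ η)
include h

lemma integral_norm_sum_iterNoise_sq_le (H K : ℕ) (s : Finset (ℕ × Fin M)) :
    ∫ ω, ‖∑ i ∈ s, iterNoise V Vt ξ L η H K i.1 i.2 H ω‖ ^ 2 ∂μ ≤ s.card * σ ^ 2 := by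
  rw [integral_norm_sum_sq s (fun i _ => h.memLp_iterNoise H K i.1 i.2 H)
    fun i _ j _ hij => h.integral_inner_iterNoise_iterNoise hij, ← nsmul_eq_mul]
  exact Finset.sum_le_card_nsmul _ _ _ fun i _ => h.integral_iterNoise_sq_le H K i.1 i.2 H

lemma integrable_lippaxOutput (H K T : ℕ) :
    Integrable (fun ω => lippaxOutput Vt η (innerStepSize L η) H K T (fun t m ℓ => ξ t m ℓ ω))
      μ := by
  simp_rw [lippaxOutput_eq]
  exact (integrable_finsetSum _ fun t _ => integrable_finsetSum _ fun m _ =>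
    (h.memLp_iterX H K t m H).integrable (by norm_num)).smul (1 / ((M : ℝ) * T))

/-- A bound for the gap from a regret bound against all comparators. -/
lemma integral_gap_le {D : ℝ} (hD : 0 ≤ D) (hσ : 0 ≤ σ) {H K T : ℕ} (hT : 0 < T) {Q : Ω → ℝ}
    {B : ℝ} (hQ : MeanLe μ Q B)
    (hreg : ∀ ω (w : Vec d),
      ∑ t ∈ Finset.range T, ∑ m, 2 * η * inner ℝ (V (iterX Vt ξ L η H K t m H ω))
        (iterX Vt ξ L η H K t m H ω - w) ≤ M * ‖w‖ ^ 2 + Q ω +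
      2 * η * inner ℝ (∑ i ∈ Finset.range T ×ˢ Finset.univ,
        iterNoise V Vt ξ L η H K i.1 i.2 H ω) w) :
    ∫ ω, gap V D (lippaxOutput Vt η (innerStepSize L η) H K T (fun t m ℓ => ξ t m ℓ ω)) ∂μ ≤
      D ^ 2 / (2 * η * T) + B / (2 * η * (M * T)) + D * σ / √(M * T) := by
  have hη := h.η_pos
  have hM : (0 : ℝ) < M := by exact_mod_cast h.M_pos
  have hT' : (0 : ℝ) < T := by exact_mod_cast hT
  set I := Finset.range T ×ˢ (Finset.univ : Finset (Fin M)) with hI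
  set N : Ω → Vec d := fun ω => ∑ i ∈ I, iterNoise V Vt ξ L η H K i.1 i.2 H ω with hN
  have hN2 : MemLp N 2 μ := memLp_finsetSum _ fun i _ => h.memLp_iterNoise H K i.1 i.2 H
  have hNle : ∫ ω, ‖N ω‖ ∂μ ≤ √(M * T) * σ := by
    have h1 := h.integral_norm_sum_iterNoise_sq_le H K I
    have h2 : (I.card : ℝ) = M * T := by simp [hI, mul_comm]
    rw [h2] at h1
    have := integral_norm_le_sqrt hN2 h1
    rwa [Real.sqrt_mul (by positivity), Real.sqrt_sq hσ] at this
  have hpath : ∀ ω, gap V D (lippaxOutput Vt η (innerStepSize L η) H K T (fun t m ℓ => ξ t m ℓ ω))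
      ≤ 1 / (2 * η * (M * T)) * (M * D ^ 2 + Q ω + 2 * η * D * ‖N ω‖) := by
    intro ω
    refine gap_le hD fun w hw => ?_
    rw [div_mul_eq_mul_div, one_mul, le_div_iff₀ (by positivity), lippaxOutput_eq]
    have e : inner ℝ (V w) ((1 / ((M : ℝ) * T)) • ∑ t ∈ Finset.range T, ∑ m,
        iterX Vt ξ L η H K t m H ω - w) * (2 * η * (M * T)) =
        ∑ t ∈ Finset.range T, ∑ m : Fin M, 2 * η * inner ℝ (V w)
          (iterX Vt ξ L η H K t m H ω - w) := by
      simp_rw [inner_sub_right, mul_sub, Finset.sum_sub_distrib, ← Finset.mul_sum, ← inner_sum]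
      rw [inner_smul_right]
      simp only [Finset.sum_const, Finset.card_univ, Fintype.card_fin, Finset.card_range,
        ← Nat.cast_smul_eq_nsmul ℝ, inner_smul_right]
      field_simp
    rw [e]
    have h1 : ∑ t ∈ Finset.range T, ∑ m : Fin M, 2 * η * inner ℝ (V w)
          (iterX Vt ξ L η H K t m H ω - w) ≤ ∑ t ∈ Finset.range T, ∑ m, 2 * η *
          inner ℝ (V (iterX Vt ξ L η H K t m H ω)) (iterX Vt ξ L η H K t m H ω - w) := by
      refine Finset.sum_le_sum fun t _ => Finset.sum_le_sum fun m _ => ?_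
      have := h.mono (iterX Vt ξ L η H K t m H ω) w
      rw [inner_sub_left] at this
      exact mul_le_mul_of_nonneg_left (by linarith) (by positivity)
    have h2 : inner ℝ (N ω) w ≤ D * ‖N ω‖ := by
      have := real_inner_le_norm (N ω) w
      nlinarith [norm_nonneg (N ω)]
    have h3 : ‖w‖ ^ 2 ≤ D ^ 2 := pow_le_pow_left₀ (norm_nonneg _) hw 2
    have h4 := hreg ω w
    have h5 := mul_le_mul_of_nonneg_left h3 hM.le
    have h6 := mul_le_mul_of_nonneg_left h2 (by positivity : 0 ≤ 2 * η)
    simp only [hN] at h6 ⊢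
    linarith
  have hm := ((MeanLe.mk (integrable_const (μ := μ) (M * D ^ 2)) (le_refl _)).add hQ).add
    ((MeanLe.mk (hN2.integrable (by norm_num)).norm hNle).const_mul
      (by positivity : 0 ≤ 2 * η * D))
  refine ((hm.const_mul (by positivity : 0 ≤ 1 / (2 * η * (M * T)))).mono
    (integrable_gap h.bound hD (h.integrable_lippaxOutput H K T)) hpath ?_).le
  simp only [integral_const, probReal_univ, one_smul]
  have hs : √((M : ℝ) * T) ≠ 0 := by positivity
  have hs2 : √((M : ℝ) * T) ^ 2 = M * T := Real.sq_sqrt (by positivity)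
  apply le_of_eq
  have e1 : D * σ / √((M : ℝ) * T) = √(M * T) * (D * σ) / (M * T) := by
    rw [div_eq_div_iff hs (by positivity)]
    linear_combination (-(D * σ)) * hs2
  rw [e1]
  field_simp

/-- One local step, from the point of view of a comparator `w`. -/
lemma iterLocal_regret (H K t : ℕ) (m : Fin M) (ω : Ω) (w : Vec d) :
    2 * η * inner ℝ (V (iterX Vt ξ L η H K t m H ω)) (iterX Vt ξ L η H K t m H ω - w) =
      ‖iterZ Vt ξ L η H K t m ω - w‖ ^ 2 - ‖iterLocal V Vt ξ L η H K t m ω - w‖ ^ 2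
      + (iterProgress V Vt ξ L η H K t m ω
        + η ^ 2 * ‖iterNoise V Vt ξ L η H K t m H ω‖ ^ 2
        + 2 * η ^ 2 * inner ℝ (V (iterX Vt ξ L η H K t m H ω)) (iterNoise V Vt ξ L η H K t m H ω)
        + (-(2 * η)) * inner ℝ (iterZ Vt ξ L η H K t m ω) (iterNoise V Vt ξ L η H K t m H ω))
      + 2 * η * inner ℝ (iterNoise V Vt ξ L η H K t m H ω) w := by
  unfold iterLocal iterProgress
  set x := iterX Vt ξ L η H K t m H ω
  set z := iterZ Vt ξ L η H K t m ω
  set e := iterNoise V Vt ξ L η H K t m H ω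
  have e1 : z - η • (V x + e) - w = (z - w) - η • (V x + e) := by abel
  rw [e1, norm_sub_sq_real (z - w), norm_smul, inner_smul_right, mul_pow, Real.norm_eq_abs, sq_abs,
    norm_add_sq_real]
  simp only [inner_sub_right, inner_sub_left, inner_add_right, real_inner_comm (V x) z,
    real_inner_comm (V x) w, real_inner_comm e w]
  ring

lemma sum_iterZ_succ_sub_sq_le (H K t : ℕ) (ω : Ω) (w : Vec d) :
    ∑ m, ‖iterZ Vt ξ L η H K (t + 1) m ω - w‖ ^ 2 ≤
      ∑ m, ‖iterLocal V Vt ξ L η H K t m ω - w‖ ^ 2 := by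
  simp_rw [iterZ_succ V]
  split_ifs
  · have := mul_norm_avg_sub_sq_le h.M_pos (fun m => iterLocal V Vt ξ L η H K t m ω) w
    simpa [avg] using this
  · exact le_rfl

/-- Gap bound without use of the averaging, for all step sizes. -/
lemma integral_gap_le_of_large {D : ℝ} (hD : 0 ≤ D) (hσ : 0 ≤ σ) {H K T : ℕ} (hT : 0 < T) :
    ∫ ω, gap V D (lippaxOutput Vt η (innerStepSize L η) H K T (fun t m ℓ => ξ t m ℓ ω)) ∂μ ≤
      D ^ 2 / (2 * η * T) + (3 * (η * σ ^ 2) + 180 * (η * G ^ 2) / 4 ^ H)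
        + D * σ / √(M * T) := by
  have hη := h.η_pos
  have hM : (0 : ℝ) < M := by exact_mod_cast h.M_pos
  have hT' : (0 : ℝ) < T := by exact_mod_cast hT
  have hQ := MeanLe.sum (μ := μ) (Finset.range T) fun t _ =>
    MeanLe.sum (μ := μ) (Finset.univ : Finset (Fin M)) fun m _ =>
      (((MeanLe.mk (h.integrable_iterProgress H K t m) (h.integral_iterProgress_le H K t m)).add
      ((MeanLe.mk (integrable_norm_sq (h.memLp_iterNoise H K t m H))
        (h.integral_iterNoise_sq_le H K t m H)).const_mul (sq_nonneg η))).add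
      (MeanLe.of_integral_eq_zero (integrable_inner (h.memLp_V_iterX H K t m H)
        (h.memLp_iterNoise H K t m H)) (h.integral_inner_iterNoise
          (h.measurable_V.comp (h.iterX_sample H K t m H)) (h.memLp_V_iterX H K t m H))
        (2 * η ^ 2))).add
      (MeanLe.of_integral_eq_zero (integrable_inner (h.memLp_iterZ H K t m)
        (h.memLp_iterNoise H K t m H)) (h.integral_inner_iterNoise
          (h.iterZ_past H K t m H) (h.memLp_iterZ H K t m)) (-(2 * η)))
  refine (h.integral_gap_le hD hσ hT hQ fun ω w => ?_).trans (le_of_eq ?_)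
  · have key : ∀ n, ∑ t ∈ Finset.range n, ∑ m, 2 * η *
        inner ℝ (V (iterX Vt ξ L η H K t m H ω)) (iterX Vt ξ L η H K t m H ω - w) ≤
        M * ‖w‖ ^ 2 - ∑ m, ‖iterZ Vt ξ L η H K n m ω - w‖ ^ 2
        + ∑ t ∈ Finset.range n, ∑ m, (iterProgress V Vt ξ L η H K t m ω
        + η ^ 2 * ‖iterNoise V Vt ξ L η H K t m H ω‖ ^ 2
        + 2 * η ^ 2 * inner ℝ (V (iterX Vt ξ L η H K t m H ω)) (iterNoise V Vt ξ L η H K t m H ω)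
        + (-(2 * η)) * inner ℝ (iterZ Vt ξ L η H K t m ω) (iterNoise V Vt ξ L η H K t m H ω))
        + ∑ t ∈ Finset.range n, ∑ m, 2 * η * inner ℝ (iterNoise V Vt ξ L η H K t m H ω) w := by
      intro n
      induction n with
      | zero =>
        have e : ∀ m : Fin M, iterZ Vt ξ L η H K 0 m ω = 0 := fun m => rfl
        simp [e]
      | succ n ih =>
        rw [Finset.sum_range_succ, Finset.sum_range_succ, Finset.sum_range_succ]
        have h1 := Finset.sum_congr rfl fun (m : Fin M) (_ : m ∈ Finset.univ) =>
          h.iterLocal_regret H K n m ω w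
        rw [Finset.sum_add_distrib, Finset.sum_add_distrib, Finset.sum_sub_distrib] at h1
        have h2 := h.sum_iterZ_succ_sub_sq_le H K n ω w
        linarith
    have h1 := key T
    have h2 : 0 ≤ ∑ m, ‖iterZ Vt ξ L η H K T m ω - w‖ ^ 2 := by positivity
    rw [Finset.sum_product, sum_inner, Finset.mul_sum]
    simp_rw [sum_inner, Finset.mul_sum]
    linarith
  · simp only [Finset.sum_const, Finset.card_univ, Fintype.card_fin, Finset.card_range,
      nsmul_eq_mul]
    field_simp
    ring

end Setting

end Regret

/-- A quantity that grows slowly and is reset every `K` steps stays small on average. -/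
lemma sum_le_of_reset {S A : ℕ → ℝ} {a N : ℝ} {K : ℕ} (hK : 0 < K) (ha : 0 ≤ a)
    (haK : a * K ≤ 1 / 32) (hN : 0 ≤ N) (hS : ∀ t, 0 ≤ S t) (hA : ∀ t, 0 ≤ A t) (hS0 : S 0 = 0)
    (hreset : ∀ t, (t + 1) % K = 0 → S (t + 1) = 0)
    (hstep : ∀ t, S (t + 1) ≤ (1 + 5 * a) * S t + 16 * a * A t + 3 / 2 * N) (T : ℕ) :
    ∑ t ∈ Finset.range T, 3 * a * S t ≤
      ∑ t ∈ Finset.range T, (2 * a * A t + 6 * (a * K) * N) := by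
  have hK1 : (1 : ℝ) ≤ K := by exact_mod_cast hK
  have key : ∀ n, ∑ t ∈ Finset.range n, 5 * a * S t + 6 * a * (K - (n % K : ℕ)) * S n ≤
      ∑ t ∈ Finset.range n, (6 * (a * K)) * (16 * a * A t + 3 / 2 * N) := by
    intro n
    induction n with
    | zero => simp [hS0]
    | succ n ih =>
      rw [Finset.sum_range_succ, Finset.sum_range_succ]
      have hmod : ((n % K : ℕ) : ℝ) + 1 ≤ K := by exact_mod_cast Nat.mod_lt n hK
      have hj0 : (0 : ℝ) ≤ (n % K : ℕ) := Nat.cast_nonneg _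
      have haS : 0 ≤ a * S n := mul_nonneg ha (hS n)
      have hR : 0 ≤ 16 * a * A n + 3 / 2 * N := by have := mul_nonneg ha (hA n); linarith
      have hR' : 0 ≤ (6 * (a * K)) * (16 * a * A n + 3 / 2 * N) := by positivity
      by_cases hr : (n + 1) % K = 0
      · rw [hreset n hr, mul_zero, add_zero]
        have : 6 * (a * S n) ≤ 6 * (a * S n) * (K - (n % K : ℕ)) :=
          le_mul_of_one_le_right (by positivity) (by linarith)
        linarith
      · have hm : (n + 1) % K = n % K + 1 := by
          rw [Nat.add_mod]
          have h1 := Nat.mod_lt n hK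
          rcases Nat.lt_or_ge 1 K with hK' | hK'
          · rw [Nat.mod_eq_of_lt hK']
            refine Nat.mod_eq_of_lt (lt_of_le_of_ne h1 fun heq => hr ?_)
            rw [Nat.add_mod, Nat.mod_eq_of_lt hK']
            exact (congrArg (· % K) heq).trans (Nat.mod_self K)
          · obtain rfl : K = 1 := by omega
            exact absurd (Nat.mod_one _) hr
        rw [hm]
        push_cast
        set j : ℝ := ((n % K : ℕ) : ℝ)
        have h1 : 6 * a * (K - (j + 1)) * S (n + 1) ≤
            6 * a * (K - (j + 1)) * ((1 + 5 * a) * S n + (16 * a * A n + 3 / 2 * N)) :=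
          mul_le_mul_of_nonneg_left (by linarith [hstep n])
            (mul_nonneg (by positivity) (by linarith))
        have h2 : a * (K - (j + 1)) ≤ a * K := mul_le_mul_of_nonneg_left (by linarith) ha
        have h3 : a * (K - (j + 1)) * (30 * (a * S n)) ≤ a * K * (30 * (a * S n)) :=
          mul_le_mul_of_nonneg_right h2 (by positivity)
        have h4 : a * K * (30 * (a * S n)) ≤ 1 / 32 * (30 * (a * S n)) :=
          mul_le_mul_of_nonneg_right haK (by positivity)
        have h5 : a * (K - (j + 1)) * (16 * a * A n + 3 / 2 * N) ≤
            a * K * (16 * a * A n + 3 / 2 * N) := mul_le_mul_of_nonneg_right h2 hR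
        nlinarith
  have h1 := key T
  have h2 : 0 ≤ 6 * a * (K - (T % K : ℕ)) * S T := by
    have : ((T % K : ℕ) : ℝ) ≤ K := by exact_mod_cast (Nat.mod_lt T hK).le
    exact mul_nonneg (mul_nonneg (by positivity) (by linarith)) (hS T)
  have h3 : ∑ t ∈ Finset.range T, 3 * a * S t = 3 / 5 * ∑ t ∈ Finset.range T, 5 * a * S t := by
    rw [Finset.mul_sum]
    exact Finset.sum_congr rfl fun t _ => by ring
  rw [h3]
  refine (mul_le_mul_of_nonneg_left (by linarith : _ ≤
    ∑ t ∈ Finset.range T, (6 * (a * K)) * (16 * a * A t + 3 / 2 * N)) (by norm_num)).trans ?_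
  rw [Finset.mul_sum]
  refine Finset.sum_le_sum fun t _ => ?_
  have h4 : a * K * (a * A t) ≤ 1 / 32 * (a * A t) :=
    mul_le_mul_of_nonneg_right haK (mul_nonneg ha (hA t))
  have h5 : 0 ≤ a * K * N := by positivity
  have h6 : 0 ≤ a * A t := mul_nonneg ha (hA t)
  nlinarith

section Consensus

variable {d : ℕ} {Ω Ξ : Type*} [MeasurableSpace Ω] [MeasurableSpace Ξ] {M : ℕ}
  {μ : Measure Ω} [IsProbabilityMeasure μ] {P : Measure Ξ} [IsProbabilityMeasure P]
  {V : Vec d → Vec d} {Vt : Vec d → Ξ → Vec d} {ξ : ℕ → Fin M → ℕ → Ω → Ξ} {L G σ η : ℝ}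

/-- The average iterate over the machines. -/
def iterMean (Vt : Vec d → Ξ → Vec d) (ξ : ℕ → Fin M → ℕ → Ω → Ξ) (L η : ℝ) (H K : ℕ)
    (t : ℕ) (ω : Ω) : Vec d :=
  avg fun m => iterZ Vt ξ L η H K t m ω

/-- Mean squared disagreement between the machines. -/
def disagreement (μ : Measure Ω) (Vt : Vec d → Ξ → Vec d)
    (ξ : ℕ → Fin M → ℕ → Ω → Ξ) (L η : ℝ) (H K : ℕ) (t : ℕ) : ℝ :=
  ∫ ω, ∑ m, ‖iterZ Vt ξ L η H K t m ω - iterMean Vt ξ L η H K t ω‖ ^ 2 ∂μ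

namespace Setting

variable (h : Setting μ P V Vt ξ L G σ η)
include h

lemma iterMean_past (H K t ℓ : ℕ) :
    Measurable[sampleAlgebra ξ (pastIndices M t ℓ)] (iterMean Vt ξ L η H K t) :=
  (Finset.measurable_fun_sum _ fun m _ => h.iterZ_past H K t m ℓ).const_smul (1 / (M : ℝ))

lemma memLp_iterMean (H K t : ℕ) : MemLp (iterMean Vt ξ L η H K t) 2 μ :=
  (memLp_finsetSum _ fun m _ => h.memLp_iterZ H K t m).const_smul (1 / (M : ℝ))

lemma memLp_iterZ_sub_iterMean (H K t : ℕ) (m : Fin M) :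
    MemLp (fun ω => iterZ Vt ξ L η H K t m ω - iterMean Vt ξ L η H K t ω) 2 μ :=
  (h.memLp_iterZ H K t m).sub (h.memLp_iterMean H K t)

lemma integrable_disagreement (H K t : ℕ) :
    Integrable (fun ω => ∑ m, ‖iterZ Vt ξ L η H K t m ω - iterMean Vt ξ L η H K t ω‖ ^ 2) μ :=
  integrable_finsetSum _ fun m _ => integrable_norm_sq (h.memLp_iterZ_sub_iterMean H K t m)

lemma iterMean_succ (H K t : ℕ) (ω : Ω) :
    iterMean Vt ξ L η H K (t + 1) ω = avg fun m => iterLocal V Vt ξ L η H K t m ω := by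
  unfold iterMean
  simp_rw [iterZ_succ V]
  split_ifs
  · have : (M : ℝ) ≠ 0 := by exact_mod_cast h.M_pos.ne'
    simp only [avg, Finset.sum_const, Finset.card_univ, Fintype.card_fin,
      ← Nat.cast_smul_eq_nsmul ℝ, smul_smul]
    congr 1
    field_simp
  · rfl

lemma disagreement_reset {H K t : ℕ} (ht : (t + 1) % K = 0) :
    disagreement μ Vt ξ L η H K (t + 1) = 0 := by
  unfold disagreement
  simp_rw [h.iterMean_succ, iterZ_succ V, if_pos ht, avg]
  simp

/-- The iterate of machine `m` after the noiseless part of its local step, relative to the step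
of the average iterate. -/
def relStep (V : Vec d → Vec d) (Vt : Vec d → Ξ → Vec d) (ξ : ℕ → Fin M → ℕ → Ω → Ξ)
    (L η : ℝ) (H K : ℕ) (t : ℕ) (m : Fin M) (ω : Ω) : Vec d :=
  (iterZ Vt ξ L η H K t m ω - iterMean Vt ξ L η H K t ω)
    - η • (V (iterX Vt ξ L η H K t m H ω) - V (iterMean Vt ξ L η H K t ω))

lemma relStep_past (H K t : ℕ) (m : Fin M) :
    Measurable[sampleAlgebra ξ (pastIndices M t H)] (relStep V Vt ξ L η H K t m) :=
  ((h.iterZ_past H K t m H).sub (h.iterMean_past H K t H)).sub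
    (((h.measurable_V.comp (h.iterX_sample H K t m H)).sub
      (h.measurable_V.comp (h.iterMean_past H K t H))).const_smul η)

lemma memLp_relStep (H K t : ℕ) (m : Fin M) : MemLp (relStep V Vt ξ L η H K t m) 2 μ := by
  unfold relStep
  have h2 : MemLp (fun ω => V (iterX Vt ξ L η H K t m H ω) - V (iterMean Vt ξ L η H K t ω)) 2 μ :=
    (h.memLp_V_iterX H K t m H).sub (h.memLp_V_of_sample (h.iterMean_past H K t 0))
  exact (h.memLp_iterZ_sub_iterMean H K t m).sub (h2.const_smul η)

lemma norm_sq_V_sub_le (H K t : ℕ) (m : Fin M) (ω : Ω) :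
    η ^ 2 * ‖V (iterX Vt ξ L η H K t m H ω) - V (iterMean Vt ξ L η H K t ω)‖ ^ 2 ≤
      2 * (η * L) ^ 2 * (‖iterX Vt ξ L η H K t m H ω - iterZ Vt ξ L η H K t m ω‖ ^ 2
        + ‖iterZ Vt ξ L η H K t m ω - iterMean Vt ξ L η H K t ω‖ ^ 2) := by
  set x := iterX Vt ξ L η H K t m H ω
  set z := iterZ Vt ξ L η H K t m ω
  set c := iterMean Vt ξ L η H K t ω
  have h1 : ‖V x - V c‖ ^ 2 ≤ (L * ‖x - c‖) ^ 2 := pow_le_pow_left₀ (norm_nonneg _) (h.smooth x c) 2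
  have h2 : ‖x - c‖ ≤ ‖x - z‖ + ‖z - c‖ := norm_sub_le_norm_sub_add_norm_sub x z c
  have h3 : ‖x - c‖ ^ 2 ≤ 2 * (‖x - z‖ ^ 2 + ‖z - c‖ ^ 2) := by
    nlinarith [norm_nonneg (x - c), sq_nonneg (‖x - z‖ - ‖z - c‖)]
  calc _ ≤ η ^ 2 * (L * ‖x - c‖) ^ 2 := mul_le_mul_of_nonneg_left h1 (sq_nonneg η)
    _ = (η * L) ^ 2 * ‖x - c‖ ^ 2 := by ring
    _ ≤ (η * L) ^ 2 * (2 * (‖x - z‖ ^ 2 + ‖z - c‖ ^ 2)) :=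
        mul_le_mul_of_nonneg_left h3 (sq_nonneg _)
    _ = _ := by ring

lemma norm_relStep_sq_le (ha : η * L ≤ 1 / 32) (H K t : ℕ) (m : Fin M) (ω : Ω) :
    ‖relStep V Vt ξ L η H K t m ω‖ ^ 2 ≤
      (1 + 5 * (η * L)) * ‖iterZ Vt ξ L η H K t m ω - iterMean Vt ξ L η H K t ω‖ ^ 2
        + 4 * (η * L) * ‖iterX Vt ξ L η H K t m H ω - iterZ Vt ξ L η H K t m ω‖ ^ 2 := by
  have hV := h.norm_sq_V_sub_le H K t m ω
  have ha0 := h.ηL_pos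
  unfold relStep
  set x := iterX Vt ξ L η H K t m H ω
  set z := iterZ Vt ξ L η H K t m ω
  set c := iterMean Vt ξ L η H K t ω
  set v := V x - V c
  set a := η * L
  have h1 : ‖(z - c) - η • v‖ ≤ ‖z - c‖ + η * ‖v‖ := by
    refine (norm_sub_le _ _).trans (le_of_eq ?_)
    rw [norm_smul, Real.norm_of_nonneg h.η_pos.le]
  have hv0 : 0 ≤ η * ‖v‖ := mul_nonneg h.η_pos.le (norm_nonneg _)
  have h2 : ‖(z - c) - η • v‖ ^ 2 ≤ (‖z - c‖ + η * ‖v‖) ^ 2 :=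
    pow_le_pow_left₀ (norm_nonneg _) h1 2
  have h3 : a * (2 * (‖z - c‖ * (η * ‖v‖))) ≤ a * (a * ‖z - c‖ ^ 2)
      + 2 * a ^ 2 * (‖x - z‖ ^ 2 + ‖z - c‖ ^ 2) := by
    nlinarith [sq_nonneg (a * ‖z - c‖ - η * ‖v‖)]
  have h4 : 2 * (‖z - c‖ * (η * ‖v‖)) ≤ a * ‖z - c‖ ^ 2
      + 2 * a * (‖x - z‖ ^ 2 + ‖z - c‖ ^ 2) := by
    refine le_of_mul_le_mul_left (h3.trans (le_of_eq ?_)) ha0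
    ring
  have h5 : a ^ 2 * (‖x - z‖ ^ 2 + ‖z - c‖ ^ 2) ≤ a / 32 * (‖x - z‖ ^ 2 + ‖z - c‖ ^ 2) :=
    mul_le_mul_of_nonneg_right (by nlinarith) (by positivity)
  have h6 : 0 ≤ a * ‖x - z‖ ^ 2 := by positivity
  have h7 : 0 ≤ a * ‖z - c‖ ^ 2 := by positivity
  nlinarith

lemma disagreement_succ_le (ha : η * L ≤ 1 / 32) (H K t : ℕ) :
    disagreement μ Vt ξ L η H K (t + 1) ≤ (1 + 5 * (η * L)) * disagreement μ Vt ξ L η H K t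
      + 16 * (η * L) * ∑ m, resolventStep μ V Vt ξ L η H K t m
      + 3 / 2 * (M * (η ^ 2 * σ ^ 2)) := by
  have ha0 := h.ηL_pos
  have hN : 0 ≤ η ^ 2 * σ ^ 2 := by positivity
  have hstep : ∀ m : Fin M, MeanLe μ (fun ω => ‖relStep V Vt ξ L η H K t m ω
      - η • iterNoise V Vt ξ L η H K t m H ω‖ ^ 2)
      (∫ ω, ‖relStep V Vt ξ L η H K t m ω‖ ^ 2 ∂μ + η ^ 2 * σ ^ 2) := fun m => by
    refine ⟨integrable_norm_sq ((h.memLp_relStep H K t m).sub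
      ((h.memLp_iterNoise H K t m H).const_smul η)), ?_⟩
    rw [integral_norm_sub_smul_sq (h.memLp_relStep H K t m) (h.memLp_iterNoise H K t m H)
      (h.integral_inner_iterNoise (h.relStep_past H K t m) (h.memLp_relStep H K t m))]
    exact add_le_add_right (mul_le_mul_of_nonneg_left (h.integral_iterNoise_sq_le H K t m H)
      (sq_nonneg η)) _
  have hrel : MeanLe μ (fun ω => ∑ m, ‖relStep V Vt ξ L η H K t m ω‖ ^ 2)
      ((1 + 5 * (η * L)) * disagreement μ Vt ξ L η H K t + ∑ m : Fin M, 4 * (η * L) *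
        (4 * resolventStep μ V Vt ξ L η H K t m + 2 * (η ^ 2 * σ ^ 2))) := by
    refine (((MeanLe.mk (h.integrable_disagreement H K t) le_rfl).const_mul
      (by positivity : 0 ≤ 1 + 5 * (η * L))).add (MeanLe.sum Finset.univ fun m _ =>
      ((MeanLe.mk (integrable_norm_sq (h.memLp_iterX_sub_iterZ H K t m))
        (h.integral_iterX_sub_iterZ_sq_le H K t m)).const_mul
        (by positivity : 0 ≤ 4 * (η * L))))).mono
      (integrable_finsetSum _ fun m _ => integrable_norm_sq (h.memLp_relStep H K t m))
      (fun ω => ?_) le_rfl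
    rw [Finset.mul_sum, ← Finset.sum_add_distrib]
    exact Finset.sum_le_sum fun m _ => h.norm_relStep_sq_le ha H K t m ω
  refine ((MeanLe.sum Finset.univ fun m _ => hstep m).mono
    (h.integrable_disagreement H K (t + 1)) (fun ω => ?_) ?_).le
  · by_cases ht : (t + 1) % K = 0
    · rw [Finset.sum_eq_zero]
      · positivity
      · intro m _
        rw [h.iterMean_succ, iterZ_succ V, if_pos ht, avg]
        simp
    · rw [h.iterMean_succ]
      simp_rw [iterZ_succ V, if_neg ht]
      refine (sum_norm_sub_avg_sq_le h.M_pos _ (iterMean Vt ξ L η H K t ω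
        - η • V (iterMean Vt ξ L η H K t ω))).trans (le_of_eq ?_)
      refine Finset.sum_congr rfl fun m _ => ?_
      congr 2
      unfold iterLocal relStep
      module
  · have h1 := hrel.le
    rw [integral_finsetSum _ fun m _ => integrable_norm_sq (h.memLp_relStep H K t m)] at h1
    rw [Finset.sum_add_distrib]
    refine (add_le_add_left h1 _).trans ?_
    rw [← Finset.mul_sum, Finset.sum_add_distrib, ← Finset.mul_sum]
    simp only [Finset.sum_const, Finset.card_univ, Fintype.card_fin, nsmul_eq_mul]
    have h2 : η * L * (M * (η ^ 2 * σ ^ 2)) ≤ 1 / 32 * (M * (η ^ 2 * σ ^ 2)) :=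
      mul_le_mul_of_nonneg_right ha (by positivity)
    have h3 : 0 ≤ (M : ℝ) * (η ^ 2 * σ ^ 2) := by positivity
    nlinarith

end Setting

end Consensus

section SmallSteps

variable {d : ℕ} {Ω Ξ : Type*} [MeasurableSpace Ω] [MeasurableSpace Ξ] {M : ℕ}
  {μ : Measure Ω} [IsProbabilityMeasure μ] {P : Measure Ξ} [IsProbabilityMeasure P]
  {V : Vec d → Vec d} {Vt : Vec d → Ξ → Vec d} {ξ : ℕ → Fin M → ℕ → Ω → Ξ} {L G σ η : ℝ}

/-- The sum over the machines of the operator values in round `t + 1`. -/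
def sumV (V : Vec d → Vec d) (Vt : Vec d → Ξ → Vec d) (ξ : ℕ → Fin M → ℕ → Ω → Ξ)
    (L η : ℝ) (H K : ℕ) (t : ℕ) (ω : Ω) : Vec d :=
  ∑ m, V (iterX Vt ξ L η H K t m H ω)

/-- The sum over the machines of the noises of the last queries in round `t + 1`. -/
def sumNoise (V : Vec d → Vec d) (Vt : Vec d → Ξ → Vec d) (ξ : ℕ → Fin M → ℕ → Ω → Ξ)
    (L η : ℝ) (H K : ℕ) (t : ℕ) (ω : Ω) : Vec d :=
  ∑ m, iterNoise V Vt ξ L η H K t m H ω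

namespace Setting

variable (h : Setting μ P V Vt ξ L G σ η)
include h

lemma memLp_sumNoise (H K t : ℕ) : MemLp (sumNoise V Vt ξ L η H K t) 2 μ :=
  memLp_finsetSum _ fun m _ => h.memLp_iterNoise H K t m H

lemma memLp_sumV (H K t : ℕ) : MemLp (sumV V Vt ξ L η H K t) 2 μ :=
  memLp_finsetSum _ fun m _ => h.memLp_V_iterX H K t m H

lemma sumV_past (H K t : ℕ) :
    Measurable[sampleAlgebra ξ (pastIndices M t H)] (sumV V Vt ξ L η H K t) :=
  Finset.measurable_fun_sum _ fun m _ => h.measurable_V.comp (h.iterX_sample H K t m H)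

lemma integral_inner_sumNoise {H K t : ℕ} {Y : Ω → Vec d}
    (hY : Measurable[sampleAlgebra ξ (pastIndices M t H)] Y) (hY2 : MemLp Y 2 μ) :
    ∫ ω, inner ℝ (Y ω) (sumNoise V Vt ξ L η H K t ω) ∂μ = 0 := by
  simp_rw [sumNoise, inner_sum]
  rw [integral_finsetSum _ fun m _ => integrable_inner hY2 (h.memLp_iterNoise H K t m H)]
  exact Finset.sum_eq_zero fun m _ => h.integral_inner_iterNoise hY hY2

lemma integral_sumNoise_sq_le (H K t : ℕ) :
    ∫ ω, ‖sumNoise V Vt ξ L η H K t ω‖ ^ 2 ∂μ ≤ M * σ ^ 2 := by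
  have h1 := h.integral_norm_sum_iterNoise_sq_le H K
    (({t} : Finset ℕ) ×ˢ (Finset.univ : Finset (Fin M)))
  simp only [Finset.sum_product, Finset.sum_singleton, Finset.card_product,
    Finset.card_singleton, Finset.card_univ, Fintype.card_fin, one_mul] at h1
  exact h1

lemma iterMean_succ_eq (H K t : ℕ) (ω : Ω) :
    iterMean Vt ξ L η H K (t + 1) ω = iterMean Vt ξ L η H K t ω
      - (η / M) • (sumV V Vt ξ L η H K t ω + sumNoise V Vt ξ L η H K t ω) := by
  rw [h.iterMean_succ]
  simp only [avg, iterMean, iterLocal, sumV, sumNoise, Finset.sum_sub_distrib,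
    Finset.sum_add_distrib, ← Finset.smul_sum, smul_sub, smul_smul]
  congr 2
  ring

/-- The disagreement of the machines costs little. -/
lemma inner_V_sub_le (H K t : ℕ) (m : Fin M) (ω : Ω) :
    2 * η * inner ℝ (V (iterX Vt ξ L η H K t m H ω) - V (iterMean Vt ξ L η H K t ω))
        (iterZ Vt ξ L η H K t m ω - iterMean Vt ξ L η H K t ω) ≤
      3 * (η * L) * ‖iterZ Vt ξ L η H K t m ω - iterMean Vt ξ L η H K t ω‖ ^ 2
        + 2 * (η * L) * ‖iterX Vt ξ L η H K t m H ω - iterZ Vt ξ L η H K t m ω‖ ^ 2 := by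
  have hV := h.norm_sq_V_sub_le H K t m ω
  have ha0 := h.ηL_pos
  set x := iterX Vt ξ L η H K t m H ω
  set z := iterZ Vt ξ L η H K t m ω
  set c := iterMean Vt ξ L η H K t ω
  set a := η * L
  have h1 := mul_le_mul_of_nonneg_left (real_inner_le_norm (V x - V c) (z - c))
    (by have := h.η_pos; positivity : 0 ≤ 2 * η * a)
  refine le_of_mul_le_mul_left ?_ ha0
  nlinarith [sq_nonneg (a * ‖z - c‖ - η * ‖V x - V c‖)]

/-- One round, from the point of view of a comparator `w`. -/
lemma iterMean_regret (H K t : ℕ) (ω : Ω) (w : Vec d) :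
    ∑ m, 2 * η * inner ℝ (V (iterX Vt ξ L η H K t m H ω)) (iterX Vt ξ L η H K t m H ω - w) ≤
      M * ‖iterMean Vt ξ L η H K t ω - w‖ ^ 2 - M * ‖iterMean Vt ξ L η H K (t + 1) ω - w‖ ^ 2
      + (∑ m, iterProgress V Vt ξ L η H K t m ω
        + 3 * (η * L) * ∑ m, ‖iterZ Vt ξ L η H K t m ω - iterMean Vt ξ L η H K t ω‖ ^ 2
        + 2 * (η * L) * ∑ m, ‖iterX Vt ξ L η H K t m H ω - iterZ Vt ξ L η H K t m ω‖ ^ 2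
        + η ^ 2 / M * ‖sumNoise V Vt ξ L η H K t ω‖ ^ 2
        + 2 * (η ^ 2 / M) * inner ℝ (sumV V Vt ξ L η H K t ω) (sumNoise V Vt ξ L η H K t ω)
        + (-(2 * η)) * inner ℝ (iterMean Vt ξ L η H K t ω) (sumNoise V Vt ξ L η H K t ω))
      + 2 * η * inner ℝ (sumNoise V Vt ξ L η H K t ω) w := by
  have hM : (0 : ℝ) < M := by exact_mod_cast h.M_pos
  have hη := h.η_pos
  have hsq := norm_sum_sq_le h.M_pos fun m => V (iterX Vt ξ L η H K t m H ω)
  have hcons := Finset.sum_le_sum fun (m : Fin M) (_ : m ∈ Finset.univ) => h.inner_V_sub_le H K t m ω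
  have hnext := h.iterMean_succ_eq H K t ω
  have hzero : ∑ m, inner ℝ (V (iterMean Vt ξ L η H K t ω))
      (iterZ Vt ξ L η H K t m ω - iterMean Vt ξ L η H K t ω) = 0 := by
    rw [← inner_sum, Finset.sum_sub_distrib, ← smul_avg h.M_pos]
    simp [iterMean, ← Nat.cast_smul_eq_nsmul ℝ]
  change ‖sumV V Vt ξ L η H K t ω‖ ^ 2 ≤ _ at hsq
  set U := sumV V Vt ξ L η H K t ω with hU
  set E := sumNoise V Vt ξ L η H K t ω
  set c := iterMean Vt ξ L η H K t ω
  have hsplit : ∀ m : Fin M, 2 * η * inner ℝ (V (iterX Vt ξ L η H K t m H ω))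
      (iterX Vt ξ L η H K t m H ω - w) =
      (iterProgress V Vt ξ L η H K t m ω - η ^ 2 * ‖V (iterX Vt ξ L η H K t m H ω)‖ ^ 2)
      + (2 * η * inner ℝ (V (iterX Vt ξ L η H K t m H ω) - V c) (iterZ Vt ξ L η H K t m ω - c)
      + 2 * η * inner ℝ (V c) (iterZ Vt ξ L η H K t m ω - c))
      + 2 * η * inner ℝ (V (iterX Vt ξ L η H K t m H ω)) (c - w) := fun m => by
    unfold iterProgress
    simp only [inner_sub_left, inner_sub_right]
    ring
  have hexp : M * ‖c - (η / M) • (U + E) - w‖ ^ 2 = M * ‖c - w‖ ^ 2 - 2 * η * inner ℝ U (c - w)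
      - 2 * η * inner ℝ c E + 2 * η * inner ℝ E w
      + η ^ 2 / M * (‖U‖ ^ 2 + 2 * inner ℝ U E + ‖E‖ ^ 2) := by
    have e1 : c - (η / M) • (U + E) - w = (c - w) - (η / M) • (U + E) := by abel
    rw [e1, norm_sub_sq_real (c - w), norm_smul, inner_smul_right, mul_pow, Real.norm_eq_abs,
      sq_abs, norm_add_sq_real]
    simp only [inner_sub_right, inner_sub_left, inner_add_right, real_inner_comm U c,
      real_inner_comm U w, real_inner_comm E w]
    field_simp
    ring
  have hsq' : η ^ 2 / M * ‖U‖ ^ 2 ≤ η ^ 2 * ∑ m, ‖V (iterX Vt ξ L η H K t m H ω)‖ ^ 2 := by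
    calc _ ≤ η ^ 2 / M * (M * ∑ m, ‖V (iterX Vt ξ L η H K t m H ω)‖ ^ 2) :=
          mul_le_mul_of_nonneg_left hsq (by positivity)
      _ = _ := by field_simp
  rw [Finset.sum_congr rfl fun m _ => hsplit m, hnext, hexp, Finset.sum_add_distrib,
    Finset.sum_add_distrib, Finset.sum_sub_distrib, Finset.sum_add_distrib,
    ← Finset.mul_sum _ _ (2 * η), ← Finset.mul_sum _ _ (2 * η), ← Finset.mul_sum _ _ (2 * η),
    ← Finset.mul_sum _ _ (η ^ 2), hzero,
    ← sum_inner (Finset.univ) (fun m => V (iterX Vt ξ L η H K t m H ω))]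
  rw [Finset.sum_add_distrib, ← Finset.mul_sum, ← Finset.mul_sum, ← Finset.mul_sum] at hcons
  change _ + 2 * η * inner ℝ U (c - w) ≤ _
  nlinarith

/-- Gap bound for step sizes that are small compared to the number of local rounds. -/
lemma integral_gap_le_of_small {D : ℝ} (hD : 0 ≤ D) (hσ : 0 ≤ σ) {H K T : ℕ} (hK : 0 < K)
    (hT : 0 < T) (haK : η * L * K ≤ 1 / 32) :
    ∫ ω, gap V D (lippaxOutput Vt η (innerStepSize L η) H K T (fun t m ℓ => ξ t m ℓ ω)) ∂μ ≤
      D ^ 2 / (2 * η * T) + (15 / 2 * (η * L * K * (η * σ ^ 2)) + η * G ^ 2 / 4 ^ H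
        + η * σ ^ 2 / (2 * M)) + D * σ / √(M * T) := by
  have hη := h.η_pos
  have ha0 := h.ηL_pos
  have hM : (0 : ℝ) < M := by exact_mod_cast h.M_pos
  have hT' : (0 : ℝ) < T := by exact_mod_cast hT
  have hK1 : (1 : ℝ) ≤ K := by exact_mod_cast hK
  have ha : η * L ≤ 1 / 32 := le_trans (le_mul_of_one_le_right ha0.le hK1) haK
  have hQ := MeanLe.sum (μ := μ) (Finset.range T) fun t _ =>
    (((((MeanLe.sum (μ := μ) (Finset.univ : Finset (Fin M)) fun m _ =>
      MeanLe.mk (h.integrable_iterProgress H K t m)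
        (h.integral_iterProgress_le_of_small H K t m)).add
      ((MeanLe.mk (h.integrable_disagreement H K t) le_rfl).const_mul
        (by positivity : 0 ≤ 3 * (η * L)))).add
      ((MeanLe.sum (Finset.univ : Finset (Fin M)) fun m _ =>
        MeanLe.mk (integrable_norm_sq (h.memLp_iterX_sub_iterZ H K t m))
        (h.integral_iterX_sub_iterZ_sq_le H K t m)).const_mul
        (by positivity : 0 ≤ 2 * (η * L)))).add
      ((MeanLe.mk (integrable_norm_sq (h.memLp_sumNoise H K t))
        (h.integral_sumNoise_sq_le H K t)).const_mul (by positivity : 0 ≤ η ^ 2 / M))).add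
      (MeanLe.of_integral_eq_zero (integrable_inner (h.memLp_sumV H K t) (h.memLp_sumNoise H K t))
        (h.integral_inner_sumNoise (h.sumV_past H K t) (h.memLp_sumV H K t))
        (2 * (η ^ 2 / M)))).add
      (MeanLe.of_integral_eq_zero
        (integrable_inner (h.memLp_iterMean H K t) (h.memLp_sumNoise H K t))
        (h.integral_inner_sumNoise (h.iterMean_past H K t H) (h.memLp_iterMean H K t))
        (-(2 * η)))
  have hB : ∑ t ∈ Finset.range T, (∑ m : Fin M, (-(1 - 8 * (η * L)) *
      resolventStep μ V Vt ξ L η H K t m + 5 * (η * L) * (η ^ 2 * σ ^ 2)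
        + 2 * (η ^ 2 * G ^ 2) / 4 ^ H) + 3 * (η * L) * disagreement μ Vt ξ L η H K t
      + 2 * (η * L) * ∑ m : Fin M,
        (4 * resolventStep μ V Vt ξ L η H K t m + 2 * (η ^ 2 * σ ^ 2))
      + η ^ 2 / M * (M * σ ^ 2) + 0 + 0) ≤
      T * (15 * (η * L * K) * (M * (η ^ 2 * σ ^ 2)) + 2 * (M * (η ^ 2 * G ^ 2)) / 4 ^ H
        + η ^ 2 * σ ^ 2) := by
    have hN : 0 ≤ (M : ℝ) * (η ^ 2 * σ ^ 2) := by positivity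
    have hA : ∀ t, 0 ≤ ∑ m, resolventStep μ V Vt ξ L η H K t m := fun t =>
      Finset.sum_nonneg fun m _ => resolventStep_nonneg H K t m
    have hS := sum_le_of_reset (S := disagreement μ Vt ξ L η H K)
      (A := fun t => ∑ m, resolventStep μ V Vt ξ L η H K t m) hK ha0.le haK hN
      (fun t => integral_nonneg fun ω => by positivity) hA
      (by
        have e : ∀ (m : Fin M) (ω : Ω), iterZ Vt ξ L η H K 0 m ω = 0 := fun m ω => rfl
        simp [disagreement, iterMean, avg, e])
      (fun t ht => h.disagreement_reset ht) (fun t => h.disagreement_succ_le ha H K t) T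
    have e1 : η ^ 2 / M * (M * σ ^ 2) = η ^ 2 * σ ^ 2 := by field_simp
    have e2 : (T : ℝ) * (15 * (η * L * K) * (M * (η ^ 2 * σ ^ 2))
        + 2 * (M * (η ^ 2 * G ^ 2)) / 4 ^ H + η ^ 2 * σ ^ 2) = ∑ t ∈ Finset.range T,
        (15 * (η * L * K) * (M * (η ^ 2 * σ ^ 2)) + 2 * (M * (η ^ 2 * G ^ 2)) / 4 ^ H
        + η ^ 2 * σ ^ 2) := by
      rw [Finset.sum_const, Finset.card_range, nsmul_eq_mul]
    rw [e1, e2, ← sub_nonneg, ← Finset.sum_sub_distrib]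
    rw [← sub_nonneg, ← Finset.sum_sub_distrib] at hS
    refine hS.trans (Finset.sum_le_sum fun t _ => ?_)
    simp only [Finset.sum_add_distrib, ← Finset.mul_sum, Finset.sum_const, Finset.card_univ,
      Fintype.card_fin, nsmul_eq_mul]
    have hA' := mul_le_mul_of_nonneg_right ha (hA t)
    have hN' : η * L * (M * (η ^ 2 * σ ^ 2)) ≤ η * L * K * (M * (η ^ 2 * σ ^ 2)) :=
      mul_le_mul_of_nonneg_right (le_mul_of_one_le_right ha0.le hK1) hN
    have e3 : (M : ℝ) * (2 * (η ^ 2 * G ^ 2) / 4 ^ H) = 2 * (M * (η ^ 2 * G ^ 2)) / 4 ^ H := by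
      ring
    have := hA t
    rw [e3]
    linarith
  refine (h.integral_gap_le hD hσ hT (hQ.mono hQ.integrable (fun _ => le_rfl) hB)
    fun ω w => ?_).trans (le_of_eq ?_)
  · have key : ∀ n, ∑ t ∈ Finset.range n, ∑ m, 2 * η *
        inner ℝ (V (iterX Vt ξ L η H K t m H ω)) (iterX Vt ξ L η H K t m H ω - w) ≤
        M * ‖w‖ ^ 2 - M * ‖iterMean Vt ξ L η H K n ω - w‖ ^ 2
        + ∑ t ∈ Finset.range n, (∑ m, iterProgress V Vt ξ L η H K t m ω
        + 3 * (η * L) * ∑ m, ‖iterZ Vt ξ L η H K t m ω - iterMean Vt ξ L η H K t ω‖ ^ 2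
        + 2 * (η * L) * ∑ m, ‖iterX Vt ξ L η H K t m H ω - iterZ Vt ξ L η H K t m ω‖ ^ 2
        + η ^ 2 / M * ‖sumNoise V Vt ξ L η H K t ω‖ ^ 2
        + 2 * (η ^ 2 / M) * inner ℝ (sumV V Vt ξ L η H K t ω) (sumNoise V Vt ξ L η H K t ω)
        + (-(2 * η)) * inner ℝ (iterMean Vt ξ L η H K t ω) (sumNoise V Vt ξ L η H K t ω))
        + ∑ t ∈ Finset.range n, 2 * η * inner ℝ (sumNoise V Vt ξ L η H K t ω) w := by
      intro n
      induction n with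
      | zero =>
        have e : iterMean Vt ξ L η H K 0 ω = 0 := by
          have : ∀ m : Fin M, iterZ Vt ξ L η H K 0 m ω = 0 := fun m => rfl
          simp [iterMean, avg, this]
        simp [e]
      | succ n ih =>
        rw [Finset.sum_range_succ, Finset.sum_range_succ, Finset.sum_range_succ]
        have h1 := h.iterMean_regret H K n ω w
        linarith
    have h1 := key T
    have h2 : 0 ≤ M * ‖iterMean Vt ξ L η H K T ω - w‖ ^ 2 := by positivity
    rw [Finset.sum_product, sum_inner, Finset.mul_sum]
    simp only [sumNoise] at h1 ⊢
    linarith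
  · field_simp

end Setting

end SmallSteps

section StepSize

variable {L D σ Lam : ℝ} {M K R : ℕ}

lemma eq_rpow_mul_rpow {x r s : ℝ} (hx : 0 < x) (h : r + s = 1) : x = x ^ r * x ^ s := by
  rw [← Real.rpow_add hx, h, Real.rpow_one]

lemma sq_eq_rpow_mul_rpow {x r s : ℝ} (hx : 0 < x) (h : r + s = 2) :
    x ^ 2 = x ^ r * x ^ s := by
  rw [← Real.rpow_add hx, h, Real.rpow_two]

lemma div_stepSize_eq {D₁ D₂ K₁ K₂ R₁ R₂ s D K R : ℝ} (hD₁ : 0 < D₁) (hK₁ : 0 < K₁)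
    (hK₂ : 0 < K₂) (hR₁ : 0 < R₁) (hR₂ : 0 < R₂) (hs : 0 < s) (hD : D ^ 2 = D₁ * D₂)
    (hK : K = K₁ * K₂) (hR : R = R₁ * R₂) :
    D ^ 2 / (D₁ / (K₁ * R₁ * s) * (K * R)) = D₂ * s / (K₂ * R₂) := by
  rw [hD, hK, hR]
  field_simp

lemma stepSize_pos (hL : 0 < L) (hLam : 0 < Lam) (hD : 0 < D) (hσ : 0 ≤ σ) (hM : 0 < M)
    (hK : 0 < K) (hR : 0 < R) : 0 < stepSize L D σ Lam M K R := by
  unfold stepSize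
  split_ifs with h
  · positivity
  · have hσ' : 0 < σ := lt_of_le_of_ne hσ (Ne.symm h)
    have hM' : 0 < √(M : ℝ) := by positivity
    simp only [lt_min_iff]
    refine ⟨?_, ?_, ?_, ?_, ?_, ?_⟩ <;> positivity

lemma stepSize_mul_le (hL : 0 < L) : stepSize L D σ Lam M K R * L ≤ 1 := by
  have : stepSize L D σ Lam M K R ≤ 1 / L := by
    unfold stepSize
    split_ifs
    · exact le_rfl
    · exact min_le_left _ _
  rwa [le_div_iff₀ hL] at this

lemma stepSize_cube_le (hL : 0 < L) (hLam : 0 < Lam) (hD : 0 < D) (hσ : 0 ≤ σ) (hM : 0 < M)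
    (hK : 0 < K) (hR : 0 < R) :
    stepSize L D σ Lam M K R ^ 3 * ((K : ℝ) ^ 2 * R * σ ^ 2 * L) ≤ D ^ 2 := by
  have hpos := stepSize_pos hL hLam hD hσ hM hK hR
  rcases hσ.eq_or_lt with h0 | hσ'
  · rw [← h0]; simp; positivity
  · have hle : stepSize L D σ Lam M K R ≤ D ^ (2 / 3 : ℝ) /
        ((K : ℝ) ^ (2 / 3 : ℝ) * (R : ℝ) ^ (1 / 3 : ℝ) * σ ^ (2 / 3 : ℝ) * L ^ (1 / 3 : ℝ)) := by
      rw [stepSize, if_neg hσ'.ne']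
      exact (min_le_right _ _).trans ((min_le_right _ _).trans (min_le_left _ _))
    rw [le_div_iff₀ (by positivity)] at hle
    have h3 := pow_le_pow_left₀ (by positivity) hle 3
    have e2 : ∀ x : ℝ, 0 ≤ x → (x ^ (2 / 3 : ℝ)) ^ 3 = x ^ 2 := fun x hx => by
      rw [← Real.rpow_natCast, ← Real.rpow_mul hx]; norm_num
    have e1 : ∀ x : ℝ, 0 ≤ x → (x ^ (1 / 3 : ℝ)) ^ 3 = x := fun x hx => by
      rw [← Real.rpow_natCast, ← Real.rpow_mul hx]; norm_num
    simpa only [mul_pow, e2 D hD.le, e2 σ hσ, e2 K (Nat.cast_nonneg K), e1 R (Nat.cast_nonneg R),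
      e1 L hL.le] using h3

lemma stepSize_sq_le (hL : 0 < L) (hLam : 0 < Lam) (hD : 0 < D) (hσ : 0 ≤ σ) (hM : 0 < M)
    (hK : 0 < K) (hR : 0 < R) :
    stepSize L D σ Lam M K R ^ 2 * ((K : ℝ) * R * σ ^ 2) ≤ D ^ 2 * M := by
  have hpos := stepSize_pos hL hLam hD hσ hM hK hR
  rcases hσ.eq_or_lt with h0 | hσ'
  · rw [← h0]; simp; positivity
  · have hle : stepSize L D σ Lam M K R ≤
        D * Real.sqrt M / ((K : ℝ) ^ (1 / 2 : ℝ) * (R : ℝ) ^ (1 / 2 : ℝ) * σ) := by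
      rw [stepSize, if_neg hσ'.ne']
      exact (min_le_right _ _).trans ((min_le_right _ _).trans ((min_le_right _ _).trans
        ((min_le_right _ _).trans (min_le_right _ _))))
    rw [le_div_iff₀ (by positivity)] at hle
    have h2 := pow_le_pow_left₀ (by positivity) hle 2
    have e1 : ∀ x : ℝ, 0 ≤ x → (x ^ (1 / 2 : ℝ)) ^ 2 = x := fun x hx => by
      rw [← Real.sqrt_eq_rpow, Real.sq_sqrt hx]
    simpa only [mul_pow, e1 K (Nat.cast_nonneg K), e1 R (Nat.cast_nonneg R),
      Real.sq_sqrt (Nat.cast_nonneg M)] using h2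

/-- The leading term of the gap bound. -/
lemma div_stepSize_le (hL : 0 < L) (hLam : 0 < Lam) (hD : 0 < D) (hσ : 0 ≤ σ) (hM : 0 < M)
    (hK : 0 < K) (hR : 0 < R) {d : ℕ} (hd : 0 < d) :
    D ^ 2 / (stepSize L D σ Lam M K R * ((K : ℝ) * R)) ≤
      (D ^ 2 * L / ((K : ℝ) * R)
          + D ^ (4 / 3 : ℝ) * L ^ (1 / 3 : ℝ) * σ ^ (2 / 3 : ℝ)
              / ((K : ℝ) ^ (1 / 3 : ℝ) * (R : ℝ) ^ (2 / 3 : ℝ))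
          + D * σ / Real.sqrt ((M : ℝ) * K * R))
      + (D ^ (8 / 5 : ℝ) * σ ^ (2 / 5 : ℝ) * L ^ (2 / 5 : ℝ)
              / ((K : ℝ) ^ (2 / 5 : ℝ) * (R : ℝ) ^ (4 / 5 : ℝ))
          + D ^ (3 / 2 : ℝ) * σ ^ (1 / 2 : ℝ) * L ^ (1 / 2 : ℝ)
              / ((K : ℝ) ^ (3 / 4 : ℝ) * (R : ℝ) ^ (3 / 4 : ℝ))
          + D ^ (5 / 3 : ℝ) * (d : ℝ) ^ (1 / 6 : ℝ) * Lam ^ (1 / 3 : ℝ) * σ ^ (2 / 3 : ℝ)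
              / ((R : ℝ) ^ (5 / 6 : ℝ) * (K : ℝ) ^ (5 / 6 : ℝ))) := by
  have hK' : (0 : ℝ) < K := by exact_mod_cast hK
  have hR' : (0 : ℝ) < R := by exact_mod_cast hR
  have hM' : (0 : ℝ) < M := by exact_mod_cast hM
  have t1 : 0 ≤ D ^ 2 * L / ((K : ℝ) * R) := by positivity
  have t2 : 0 ≤ D ^ (4 / 3 : ℝ) * L ^ (1 / 3 : ℝ) * σ ^ (2 / 3 : ℝ)
              / ((K : ℝ) ^ (1 / 3 : ℝ) * (R : ℝ) ^ (2 / 3 : ℝ)) := by positivity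
  have t3 : 0 ≤ D * σ / Real.sqrt ((M : ℝ) * K * R) := by positivity
  have t4 : 0 ≤ D ^ (8 / 5 : ℝ) * σ ^ (2 / 5 : ℝ) * L ^ (2 / 5 : ℝ)
              / ((K : ℝ) ^ (2 / 5 : ℝ) * (R : ℝ) ^ (4 / 5 : ℝ)) := by positivity
  have t5 : 0 ≤ D ^ (3 / 2 : ℝ) * σ ^ (1 / 2 : ℝ) * L ^ (1 / 2 : ℝ)
              / ((K : ℝ) ^ (3 / 4 : ℝ) * (R : ℝ) ^ (3 / 4 : ℝ)) := by positivity
  have t6 : 0 ≤ D ^ (5 / 3 : ℝ) * (d : ℝ) ^ (1 / 6 : ℝ) * Lam ^ (1 / 3 : ℝ) * σ ^ (2 / 3 : ℝ)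
              / ((R : ℝ) ^ (5 / 6 : ℝ) * (K : ℝ) ^ (5 / 6 : ℝ)) := by positivity
  have c1 : D ^ 2 / (1 / L * ((K : ℝ) * R)) = D ^ 2 * L / ((K : ℝ) * R) := by field_simp
  unfold stepSize
  split_ifs with h0
  · rw [c1]; linarith
  have hσ' : 0 < σ := lt_of_le_of_ne hσ (Ne.symm h0)
  have hmin : ∀ {x y B : ℝ}, D ^ 2 / (x * ((K : ℝ) * R)) ≤ B → D ^ 2 / (y * ((K : ℝ) * R)) ≤ B →
      D ^ 2 / (min x y * ((K : ℝ) * R)) ≤ B := fun {x y B} hx hy => by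
    rcases min_choice x y with hc | hc <;> rw [hc] <;> assumption
  refine hmin ?_ (hmin ?_ (hmin ?_ (hmin ?_ (hmin ?_ ?_))))
  · rw [c1]; linarith
  · have e := div_stepSize_eq (s := σ ^ (2 / 5 : ℝ) * L ^ (2 / 5 : ℝ))
      (Real.rpow_pos_of_pos hD (2 / 5)) (Real.rpow_pos_of_pos hK' (3 / 5))
      (Real.rpow_pos_of_pos hK' (2 / 5)) (Real.rpow_pos_of_pos hR' (1 / 5))
      (Real.rpow_pos_of_pos hR' (4 / 5)) (by positivity)
      (sq_eq_rpow_mul_rpow hD (by norm_num : (2 / 5 : ℝ) + 8 / 5 = 2))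
      (eq_rpow_mul_rpow hK' (by norm_num)) (eq_rpow_mul_rpow hR' (by norm_num))
    simp only [← mul_assoc] at e ⊢
    rw [e]; linarith
  · have e := div_stepSize_eq (s := σ ^ (2 / 3 : ℝ) * L ^ (1 / 3 : ℝ))
      (Real.rpow_pos_of_pos hD (2 / 3)) (Real.rpow_pos_of_pos hK' (2 / 3))
      (Real.rpow_pos_of_pos hK' (1 / 3)) (Real.rpow_pos_of_pos hR' (1 / 3))
      (Real.rpow_pos_of_pos hR' (2 / 3)) (by positivity)
      (sq_eq_rpow_mul_rpow hD (by norm_num : (2 / 3 : ℝ) + 4 / 3 = 2))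
      (eq_rpow_mul_rpow hK' (by norm_num)) (eq_rpow_mul_rpow hR' (by norm_num))
    simp only [← mul_assoc] at e ⊢
    rw [e, mul_right_comm (D ^ (4 / 3 : ℝ))]; linarith
  · have e := div_stepSize_eq (s := σ ^ (1 / 2 : ℝ) * L ^ (1 / 2 : ℝ))
      (Real.rpow_pos_of_pos hD (1 / 2)) (Real.rpow_pos_of_pos hK' (1 / 4))
      (Real.rpow_pos_of_pos hK' (3 / 4)) (Real.rpow_pos_of_pos hR' (1 / 4))
      (Real.rpow_pos_of_pos hR' (3 / 4)) (by positivity)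
      (sq_eq_rpow_mul_rpow hD (by norm_num : (1 / 2 : ℝ) + 3 / 2 = 2))
      (eq_rpow_mul_rpow hK' (by norm_num)) (eq_rpow_mul_rpow hR' (by norm_num))
    simp only [← mul_assoc] at e ⊢
    rw [e]; linarith
  · have e := div_stepSize_eq (s := Lam ^ (1 / 3 : ℝ) * σ ^ (2 / 3 : ℝ))
      (Real.rpow_pos_of_pos hD (1 / 3)) (Real.rpow_pos_of_pos hK' (1 / 6))
      (Real.rpow_pos_of_pos hK' (5 / 6)) (Real.rpow_pos_of_pos hR' (1 / 6))
      (Real.rpow_pos_of_pos hR' (5 / 6)) (by positivity)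
      (sq_eq_rpow_mul_rpow hD (by norm_num : (1 / 3 : ℝ) + 5 / 3 = 2))
      (eq_rpow_mul_rpow hK' (by norm_num)) (eq_rpow_mul_rpow hR' (by norm_num))
    have hd1 : 1 ≤ (d : ℝ) ^ (1 / 6 : ℝ) :=
      Real.one_le_rpow (by exact_mod_cast hd) (by norm_num)
    have e' : Lam ^ (1 / 3 : ℝ) * σ ^ (2 / 3 : ℝ) * (R : ℝ) ^ (1 / 6 : ℝ) * (K : ℝ) ^ (1 / 6 : ℝ) =
        (K : ℝ) ^ (1 / 6 : ℝ) * (R : ℝ) ^ (1 / 6 : ℝ) *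
          (Lam ^ (1 / 3 : ℝ) * σ ^ (2 / 3 : ℝ)) := by ring
    rw [e', e]
    have : D ^ (5 / 3 : ℝ) * (Lam ^ (1 / 3 : ℝ) * σ ^ (2 / 3 : ℝ))
        / ((K : ℝ) ^ (5 / 6 : ℝ) * (R : ℝ) ^ (5 / 6 : ℝ)) ≤
        D ^ (5 / 3 : ℝ) * (d : ℝ) ^ (1 / 6 : ℝ) * Lam ^ (1 / 3 : ℝ) * σ ^ (2 / 3 : ℝ)
              / ((R : ℝ) ^ (5 / 6 : ℝ) * (K : ℝ) ^ (5 / 6 : ℝ)) := by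
      rw [mul_comm ((K : ℝ) ^ (5 / 6 : ℝ))]
      refine div_le_div_of_nonneg_right ?_ (by positivity)
      have := le_mul_of_one_le_right
        (by positivity : 0 ≤ D ^ (5 / 3 : ℝ) * (Lam ^ (1 / 3 : ℝ) * σ ^ (2 / 3 : ℝ))) hd1
      linarith
    linarith
  · have e : D ^ 2 / (D * √(M : ℝ) / ((K : ℝ) ^ (1 / 2 : ℝ) * (R : ℝ) ^ (1 / 2 : ℝ) * σ)
        * ((K : ℝ) * R)) = D * σ / √((M : ℝ) * K * R) := by
      rw [← Real.sqrt_eq_rpow, ← Real.sqrt_eq_rpow, mul_assoc (M : ℝ), Real.sqrt_mul hM'.le,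
        Real.sqrt_mul hK'.le]
      have hsK : √(K : ℝ) ^ 2 = K := Real.sq_sqrt hK'.le
      have hsR : √(R : ℝ) ^ 2 = R := Real.sq_sqrt hR'.le
      have h1 : 0 < √(K : ℝ) := by positivity
      have h2 : 0 < √(R : ℝ) := by positivity
      have h3 : 0 < √(M : ℝ) := by positivity
      rw [div_eq_div_iff (by positivity) (by positivity)]
      field_simp
      rw [hsK, hsR]
    rw [e]; linarith

end StepSize

end FedVI

end

theorem mainTheorem6 {d : ℕ} {Ω Ξ : Type*} [MeasurableSpace Ω] [MeasurableSpace Ξ]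
    (μ : MeasureTheory.Measure Ω) [MeasureTheory.IsProbabilityMeasure μ]
    (P : MeasureTheory.Measure Ξ) [MeasureTheory.IsProbabilityMeasure P]
    (V : FedVI.Vec d → FedVI.Vec d) (Vt : FedVI.Vec d → Ξ → FedVI.Vec d)
    (L G σ Lam D : ℝ) (M K R H : ℕ) (ξ : ℕ → Fin M → ℕ → Ω → Ξ) (η γ : ℝ)
    (hL : 0 < L) (hLam : 0 < Lam) (hD : 0 < D) (hσ : 0 ≤ σ)
    (hM : 1 ≤ M) (hK : 1 ≤ K) (hR : 1 ≤ R)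
    (hmono : FedVI.MonotoneOp V) (hsmooth : FedVI.SmoothOp L V) (hG : ∀ x, ‖V x‖ ≤ G)
    (hsecond : FedVI.SecondOrderBounded Lam V)
    (horacle : FedVI.IsOracle V Vt P σ) (hξ : FedVI.IsIIDSample ξ P μ)
    (hη : η = FedVI.stepSize L D σ Lam M K R) (hη1 : η ≤ 1)
    (hγ : γ = FedVI.innerStepSize L η) :
    MeasureTheory.Integrable (fun ω => FedVI.gap V D
      (FedVI.lippaxOutput Vt η γ H K (K * R) (fun t m ℓ => ξ t m ℓ ω))) μ ∧
    ∫ ω, FedVI.gap V D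
      (FedVI.lippaxOutput Vt η γ H K (K * R) (fun t m ℓ => ξ t m ℓ ω)) ∂μ
    ≤ 240 * (D ^ 2 * L / ((K : ℝ) * R)
          + D ^ (4 / 3 : ℝ) * L ^ (1 / 3 : ℝ) * σ ^ (2 / 3 : ℝ)
              / ((K : ℝ) ^ (1 / 3 : ℝ) * (R : ℝ) ^ (2 / 3 : ℝ))
          + D * σ / Real.sqrt ((M : ℝ) * K * R))
      + 240 * (D ^ (8 / 5 : ℝ) * σ ^ (2 / 5 : ℝ) * L ^ (2 / 5 : ℝ)
              / ((K : ℝ) ^ (2 / 5 : ℝ) * (R : ℝ) ^ (4 / 5 : ℝ))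
          + D ^ (3 / 2 : ℝ) * σ ^ (1 / 2 : ℝ) * L ^ (1 / 2 : ℝ)
              / ((K : ℝ) ^ (3 / 4 : ℝ) * (R : ℝ) ^ (3 / 4 : ℝ))
          + D ^ (5 / 3 : ℝ) * (d : ℝ) ^ (1 / 6 : ℝ) * Lam ^ (1 / 3 : ℝ) * σ ^ (2 / 3 : ℝ)
              / ((R : ℝ) ^ (5 / 6 : ℝ) * (K : ℝ) ^ (5 / 6 : ℝ)))
      + (10 * (H : ℝ) ^ 2 * Lam ^ 2 * G ^ 4 + 60 * G ^ 2 + 120 * G ^ 2 * (K : ℝ) ^ 2)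
          / 4 ^ H := by
  have hpos : 0 < η := hη ▸ FedVI.stepSize_pos hL hLam hD hσ hM hK hR
  have hs : FedVI.Setting μ P V Vt ξ L G σ η :=
    ⟨hmono, hsmooth, hG, horacle, hξ, hL, hpos, hη ▸ FedVI.stepSize_mul_le hL, hM⟩
  have hcube := FedVI.stepSize_cube_le hL hLam hD hσ hM hK hR
  have hsq := FedVI.stepSize_sq_le hL hLam hD hσ hM hK hR
  rw [← hη] at hcube hsq
  subst hγ
  refine ⟨FedVI.integrable_gap hG hD.le (hs.integrable_lippaxOutput H K (K * R)), ?_⟩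
  have hK' : (1 : ℝ) ≤ K := by exact_mod_cast hK
  have hR' : (1 : ℝ) ≤ R := by exact_mod_cast hR
  have hM' : (1 : ℝ) ≤ M := by exact_mod_cast hM
  rcases Nat.eq_zero_or_pos d with hd | hd
  · subst hd
    refine le_trans (MeasureTheory.integral_nonpos fun ω => ?_) (by positivity)
    refine FedVI.gap_le hD.le fun w _ => le_of_eq ?_
    rw [Subsingleton.elim (V w) 0, inner_zero_left]
    rfl
  have hT : 0 < K * R := Nat.mul_pos hK hR
  have hlead := FedVI.div_stepSize_le hL hLam hD hσ hM hK hR hd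
  rw [← hη] at hlead
  have hGK : ∀ c : ℝ, c ≤ 180 → c * (η * G ^ 2) / 4 ^ H ≤
      (10 * (H : ℝ) ^ 2 * Lam ^ 2 * G ^ 4 + 60 * G ^ 2 + 120 * G ^ 2 * (K : ℝ) ^ 2) / 4 ^ H := by
    intro c hc
    refine div_le_div_of_nonneg_right ?_ (by positivity)
    have h1 : 0 ≤ 10 * (H : ℝ) ^ 2 * Lam ^ 2 * G ^ 4 := by positivity
    have h2 : G ^ 2 * 1 ≤ G ^ 2 * (K : ℝ) ^ 2 :=
      mul_le_mul_of_nonneg_left (by nlinarith) (sq_nonneg G)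
    have h3 : c * (η * G ^ 2) ≤ 180 * (η * G ^ 2) := mul_le_mul_of_nonneg_right hc (by positivity)
    have h4 : η * G ^ 2 ≤ 1 * G ^ 2 := mul_le_mul_of_nonneg_right hη1 (sq_nonneg G)
    linarith
  have eT : ((K * R : ℕ) : ℝ) = (K : ℝ) * R := by push_cast; rfl
  have eM : (M : ℝ) * ((K : ℝ) * R) = M * K * R := by ring
  have eD : D ^ 2 / (2 * η * ((K : ℝ) * R)) = 1 / 2 * (D ^ 2 / (η * (K * R))) := by
    field_simp
  have hnoise : η * L * K * (η * σ ^ 2) ≤ D ^ 2 / (η * (K * R)) := by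
    rw [le_div_iff₀ (by positivity)]
    linarith
  have t2 : 0 ≤ D ^ 2 * L / ((K : ℝ) * R) := by positivity
  have t3 : 0 ≤ D ^ (4 / 3 : ℝ) * L ^ (1 / 3 : ℝ) * σ ^ (2 / 3 : ℝ)
      / ((K : ℝ) ^ (1 / 3 : ℝ) * (R : ℝ) ^ (2 / 3 : ℝ)) := by positivity
  have t4 : 0 ≤ D ^ (8 / 5 : ℝ) * σ ^ (2 / 5 : ℝ) * L ^ (2 / 5 : ℝ)
      / ((K : ℝ) ^ (2 / 5 : ℝ) * (R : ℝ) ^ (4 / 5 : ℝ)) := by positivity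
  have t5 : 0 ≤ D ^ (3 / 2 : ℝ) * σ ^ (1 / 2 : ℝ) * L ^ (1 / 2 : ℝ)
      / ((K : ℝ) ^ (3 / 4 : ℝ) * (R : ℝ) ^ (3 / 4 : ℝ)) := by positivity
  have t6 : 0 ≤ D ^ (5 / 3 : ℝ) * (d : ℝ) ^ (1 / 6 : ℝ) * Lam ^ (1 / 3 : ℝ) * σ ^ (2 / 3 : ℝ)
      / ((R : ℝ) ^ (5 / 6 : ℝ) * (K : ℝ) ^ (5 / 6 : ℝ)) := by positivity
  have t7 : 0 ≤ D * σ / √((M : ℝ) * K * R) := by positivity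
  rcases le_total (η * L * K) (1 / 32) with ha | ha
  · have h1 := hs.integral_gap_le_of_small (H := H) hD.le hσ hK hT ha
    have h2 : η * σ ^ 2 / (2 * M) ≤ D * σ / √((M : ℝ) * K * R) := by
      have h3 : η * σ * √((M : ℝ) * K * R) ≤ D * M := by
        refine le_of_sq_le_sq ?_ (by positivity)
        rw [mul_pow, Real.sq_sqrt (by positivity)]
        have := mul_le_mul_of_nonneg_right hsq (by positivity : (0 : ℝ) ≤ M)
        linarith
      rw [div_le_div_iff₀ (by positivity) (by positivity)]
      have := mul_le_mul_of_nonneg_right h3 hσ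
      have : 0 ≤ D * M * σ := by positivity
      linarith
    have h3 := hGK 1 (by norm_num)
    rw [one_mul] at h3
    rw [eT, eD, eM] at h1
    linarith
  · have h1 := hs.integral_gap_le_of_large (H := H) (K := K) hD.le hσ hT
    have h2 : 1 / 32 * (η * σ ^ 2) ≤ η * L * K * (η * σ ^ 2) :=
      mul_le_mul_of_nonneg_right ha (by positivity)
    have h3 := hGK 180 le_rfl
    rw [eT, eD, eM] at h1
    linarith
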